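/- Let $\mu$ be a probability measure on $\mathbb C$ supported in the unit circle, and let $Z=Z_1,Z_2,\dots$ be i.i.d. complex random variables with law $\mu$ on a probability space $(\Omega,\mathbb P)$. Put $P_n(z)=\prod_{j=1}^n(z-Z_j)$ for $n\ge 2$. (A) Let $\lambda_{n,j}:\Omega\to\mathbb C$ ($n\ge2$, $1\le j\le n$) satisfy $\sum_{j=1}^n\lambda_{n,j}\ne0$ for all $n$ a.s., so that the polynomial $$Q_n(z)=P_n(z)\sum_{j=1}^n\frac{\lambda_{n,j}}{z-Z_j}$$ has degree $n-1$ a.s. Let $W_{n,1},\dots,W_{n,n-1}$ be its zeros (with multiplicity) and $\mu_n=\frac1{n-1}\sum_{j=1}^{n-1}\delta_{W_{n,j}}$. Assume that there are constants $M,K,\delta>0$ and $b_0,b_1,\dots\in\mathbb C$, with at least one $b_m\ne0$, such that $|W_{n,j}|\le M$ for all $n,j$ a.s., and (i) $\frac1n\sum_{j=1}^n\overline{\lambda_{n,j}}\,Z_j^{m+1}\to b_m$ as $n\to\infty$ a.s., for every $m=0,1,2,\dots$; (ii) $\frac1n\sum_{j=1}^n|\lambda_{n,j}|\le K$ for all $n$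 a.s.; (iii) $\frac1n\bigl|\sum_{j=1}^n\lambda_{n,j}\bigr|\ge\delta$ for all $n$ a.s. Then, almost surely, $\mu_n$ converges weakly to $\mu$ as $n\to\infty$. In each of the following two cases all the assumptions of (A) are satisfied for suitable constants, and hence $\mu_n\to\mu$ weakly almost surely. (B) $\lambda_{n,j}=\xi-Z_j$, i.e. $Q_n$ is the polar derivative $D_\xi P_n(z)=nP_n(z)-(z-\xi)P_n'(z)$, where $\xi\in\mathbb C$, $|\xi|>1$ and, if $\mu$ is not the uniform distribution on the unit circle and $\mathbb E[Z]\neq0$, also $|\xi|>1/|\mathbb E[Z]|$. (C) $Q_n$ is a Sz.-Nagy generalized derivative of $P_n$, i.e. a.s. $\lambda_{n,j}>0$ for all $j$ and $\sum_{j=1}^n\lambda_{n,j}=n$, each $\lambda_{n,j}$ is a.s. equal to a constant (which may depend on $n$ and $j$), there is a constant $M'>0$ with $\lambda_{n,j}\le M'$ a.s. for all $n,j$, and $\mu$ is not the uniform distribution on the unit circle. -/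

import Mathlib

open MeasureTheory ProbabilityTheory Filter Topology Polynomial
open scoped NNReal

namespace RandomZeros

noncomputable section

/-- The monic polynomial `(X - z 0) ⋯ (X - z (n-1))`. -/
def polyOfZeros (n : ℕ) (z : ℕ → ℂ) : ℂ[X] :=
  ∏ j ∈ Finset.range n, (X - C (z j))

/-- The polynomial `P(X) * ∑ j, lam j / (X - z j)` with `P = polyOfZeros n z`, written without
division: `∑ j, lam j * ∏ i ≠ j, (X - z i)`. -/
def genDeriv (n : ℕ) (z lam : ℕ → ℂ) : ℂ[X] :=
  ∑ j ∈ Finset.range n, C (lam j) * ∏ i ∈ (Finset.range n).erase j, (X - C (z i))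

/-- Away from the zeros of `P`, `genDeriv` is literally `P(x) * ∑ j, lam j / (x - z j)`. -/
theorem eval_genDeriv (n : ℕ) (z lam : ℕ → ℂ) (x : ℂ) (hx : ∀ j < n, x ≠ z j) :
    (genDeriv n z lam).eval x =
      (polyOfZeros n z).eval x * ∑ j ∈ Finset.range n, lam j / (x - z j) := by
  simp only [genDeriv, polyOfZeros, eval_finsetSum, eval_mul, eval_C, eval_prod, eval_sub, eval_X,
    Finset.mul_sum]
  refine Finset.sum_congr rfl fun j hj => ?_
  have h : x - z j ≠ 0 := sub_ne_zero.mpr (hx j (Finset.mem_range.mp hj))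
  rw [← Finset.mul_prod_erase _ _ hj]
  field_simp

/-- The polar derivative `D_ξ P = (deg P) P - (X - ξ) P'`. -/
def polarDerivative (ξ : ℂ) (P : ℂ[X]) : ℂ[X] :=
  C (P.natDegree : ℂ) * P - (X - C ξ) * derivative P

/-- The polar derivative of `P = (X - z 0) ⋯ (X - z (n-1))` is the generalized derivative of `P`
with weights `ξ - z j`. -/
theorem polarDerivative_polyOfZeros (ξ : ℂ) (n : ℕ) (z : ℕ → ℂ) :
    polarDerivative ξ (polyOfZeros n z) = genDeriv n z (fun j => ξ - z j) := by
  have hdeg : (polyOfZeros n z).natDegree = n := by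
    simp [polyOfZeros, natDegree_prod_of_monic _ _ (fun j _ => monic_X_sub_C (z j))]
  have hder : derivative (polyOfZeros n z) =
      ∑ j ∈ Finset.range n, ∏ i ∈ (Finset.range n).erase j, (X - C (z i)) := by
    simp [polyOfZeros, derivative_prod_finset]
  have hP : C (n : ℂ) * polyOfZeros n z = ∑ j ∈ Finset.range n,
      (X - C (z j)) * ∏ i ∈ (Finset.range n).erase j, (X - C (z i)) := by
    rw [Finset.sum_congr rfl fun j hj => Finset.mul_prod_erase (Finset.range n)
      (fun i => (X - C (z i) : ℂ[X])) hj]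
    simp [polyOfZeros]
  rw [polarDerivative, hdeg, hder, hP, genDeriv, Finset.mul_sum, ← Finset.sum_sub_distrib]
  refine Finset.sum_congr rfl fun j _ => ?_
  rw [C_sub]
  ring

/-- `c 0, …, c (n-1)` are weights of a Sz.-Nagy generalized derivative of a polynomial of degree
`n`: positive reals with sum `n`. -/
def IsNagyWeights (n : ℕ) (c : ℕ → ℝ) : Prop :=
  (∀ j < n, 0 < c j) ∧ ∑ j ∈ Finset.range n, c j = n

/-- The empirical measure `(n-1)⁻¹ ∑ w, δ_w`, where `w` runs through the zeros of `Q` counted with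
multiplicity; a probability measure when `n ≥ 2` and `deg Q = n - 1`. `FiniteMeasure ℂ` carries
the topology of weak convergence. -/
def zeroMeasure (n : ℕ) (Q : ℂ[X]) : FiniteMeasure ℂ :=
  ((n - 1 : ℕ) : ℝ≥0)⁻¹ • (Q.roots.map fun w => (diracProba w).toFiniteMeasure).sum

/-- The uniform distribution on the unit circle: the law of `exp (i θ)`, with `θ` uniformly
distributed on `(0, 2π]`. -/
def uniformCircle : Measure ℂ :=
  (cond (volume : Measure ℝ) (Set.Ioc 0 (2 * Real.pi))).map (circleMap 0 1)

/-- The assumptions on the random weights `lam n j` (for `n ≥ 2`, `j < n`), given the random zeros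
`Z 0, Z 1, …`. -/
structure WeightConditions {Ω : Type*} [MeasurableSpace Ω] (Pr : Measure Ω)
    (Z : ℕ → Ω → ℂ) (lam : ℕ → ℕ → Ω → ℂ) : Prop where
  /-- The weights do not sum to zero, so that `genDeriv` has degree `n - 1`. -/
  sum_ne_zero : ∀ᵐ ω ∂Pr, ∀ n ≥ 2, ∑ j ∈ Finset.range n, lam n j ω ≠ 0
  /-- The zeros of all the generalized derivatives are bounded by a common constant. -/
  zeros_bounded : ∃ M : ℝ, 0 < M ∧ ∀ᵐ ω ∂Pr, ∀ n : ℕ, n ≥ 2 →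
    ∀ w ∈ (genDeriv n (fun j => Z j ω) (fun j => lam n j ω)).roots, ‖w‖ ≤ M
  /-- Condition (i). -/
  moments : ∃ b : ℕ → ℂ, (∃ m, b m ≠ 0) ∧ ∀ m : ℕ, ∀ᵐ ω ∂Pr,
    Tendsto (fun n : ℕ => (1 / (n : ℂ)) *
      ∑ j ∈ Finset.range n, (starRingEnd ℂ) (lam n j ω) * Z j ω ^ (m + 1)) atTop (𝓝 (b m))
  /-- Condition (ii). -/
  abs_le : ∃ K : ℝ, 0 < K ∧ ∀ᵐ ω ∂Pr, ∀ n : ℕ, n ≥ 2 →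
    (1 / (n : ℝ)) * ∑ j ∈ Finset.range n, ‖lam n j ω‖ ≤ K
  /-- Condition (iii). -/
  le_abs_sum : ∃ δ : ℝ, 0 < δ ∧ ∀ᵐ ω ∂Pr, ∀ n : ℕ, n ≥ 2 →
    δ ≤ (1 / (n : ℝ)) * ‖∑ j ∈ Finset.range n, lam n j ω‖

end

end RandomZeros

open RandomZeros

/-! Fix a realisation of the points and weights. Weak convergence of the zero measures rests on two
facts: their moments converge to those of `μ`, and all but a bounded number of zeros lie near the
unit circle. Both are needed. On the circle, polynomials in `w` and `conj w` are uniformly dense and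
the averages of `conj (q w)` are conjugates of holomorphic averages, so moments determine
everything; off the circle this density fails.

Moments: with `G = ∑ λ_j / (1 - z_j X)`, the reversed polynomial of `Q_n` is `∏ (1 - z_j X) * G`, up
to the constant `∑ λ_j`. Taking logarithmic derivatives gives `G * (p_Z - p_W) = G'` for the
generating functions of the power sums. The coefficients of `G` are `O(n)` by (ii) and its constant
term is at least `nδ` by (iii), so each power sum changes by only `O(1)` (`exists_powerSum_sub_le`).
The strong law handles the original points.

Concentration: a Jensen-type estimate (`norm_center_mul_pow_le`) bounds the number of zeros of `F(x)
= ∑ λ_j / (x - z_j)` in a disk by comparing `F` at the centre with `F` on a slightly larger circle.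
Outside the unit disk the centre is infinity, where (iii) gives the lower bound. Inside it is a
point near `0`: the Taylor coefficients of `F / n` at `0` tend to `-conj b_m`, and some `b_m` is
nonzero (`exists_lower_bound_near_zero`).

For polar derivatives, `b_0 = conj ξ * E[Z] - 1` is nonzero. For Sz.-Nagy weights, `b_m =
E[Z^(m+1)]`; some moment is nonzero since moments determine a measure on the circle, and the limits
in (i) follow from Hoeffding's inequality and Borel–Cantelli. -/

namespace RandomZeros

/-! ### Generating functions and power sums of the zeros. -/

section Algebra

variable {n : ℕ} {z lam : ℕ → ℂ}

theorem natDegree_genDeriv_summand (j : ℕ) (hj : j ∈ Finset.range n) :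
    (∏ i ∈ (Finset.range n).erase j, (X - C (z i))).natDegree = n - 1 := by
  rw [natDegree_prod_of_monic _ _ (fun i _ => monic_X_sub_C (z i))]
  simp [Finset.card_erase_of_mem hj]

theorem coeff_genDeriv : (genDeriv n z lam).coeff (n - 1) = ∑ j ∈ Finset.range n, lam j := by
  rw [genDeriv, finsetSum_coeff]
  refine Finset.sum_congr rfl fun j hj => ?_
  have hm : (∏ i ∈ (Finset.range n).erase j, (X - C (z i))).Monic :=
    monic_prod_of_monic _ _ fun i _ => monic_X_sub_C (z i)
  rw [coeff_C_mul, ← natDegree_genDeriv_summand (z := z) j hj, hm.coeff_natDegree, mul_one]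

theorem natDegree_genDeriv (h : ∑ j ∈ Finset.range n, lam j ≠ 0) :
    (genDeriv n z lam).natDegree = n - 1 := by
  refine natDegree_eq_of_le_of_coeff_ne_zero ?_ (by rwa [coeff_genDeriv])
  refine natDegree_sum_le_of_forall_le _ _ fun j hj => ?_
  exact (natDegree_C_mul_le _ _).trans (natDegree_genDeriv_summand j hj).le

theorem card_roots_genDeriv (h : ∑ j ∈ Finset.range n, lam j ≠ 0) :
    Multiset.card (genDeriv n z lam).roots = n - 1 := by
  rw [← (IsAlgClosed.splits (genDeriv n z lam)).natDegree_eq_card_roots, natDegree_genDeriv h]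

theorem eval_genDeriv_eq_prod_roots (h : ∑ j ∈ Finset.range n, lam j ≠ 0) (x : ℂ) :
    (genDeriv n z lam).eval x = (∑ j ∈ Finset.range n, lam j) *
      ((genDeriv n z lam).roots.map fun w => x - w).prod := by
  rw [(IsAlgClosed.splits (genDeriv n z lam)).eval_eq_prod_roots x, leadingCoeff,
    natDegree_genDeriv h, coeff_genDeriv]

/-- Substituting `y⁻¹` and multiplying by `y ^ (n - 1)` reverses the polynomial, which makes
infinity the regular point `y = 0`. Both the power sums and the count of outer zeros are read off
from this form. -/
theorem sum_mul_prod_one_sub_roots (h : ∑ j ∈ Finset.range n, lam j ≠ 0) (y : ℂ) :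
    (∑ j ∈ Finset.range n, lam j) * ((genDeriv n z lam).roots.map fun w => 1 - w * y).prod =
      ∑ j ∈ Finset.range n, lam j * ∏ i ∈ (Finset.range n).erase j, (1 - z i * y) := by
  rcases eq_or_ne y 0 with rfl | hy
  · simp
  have h1 := eval_genDeriv_eq_prod_roots (z := z) h y⁻¹
  have h2 : ((genDeriv n z lam).roots.map fun w => 1 - w * y).prod =
      y ^ (n - 1) * ((genDeriv n z lam).roots.map fun w => y⁻¹ - w).prod := by
    have h3 : ((genDeriv n z lam).roots.map fun _ => y).prod = y ^ (n - 1) := by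
      rw [Multiset.map_const', Multiset.prod_replicate, card_roots_genDeriv h]
    rw [← h3, ← Multiset.prod_map_mul]
    refine congrArg Multiset.prod (Multiset.map_congr rfl fun w _ => ?_)
    field_simp
  rw [h2, mul_left_comm, ← h1, genDeriv, eval_finsetSum, Finset.mul_sum]
  refine Finset.sum_congr rfl fun j hj => ?_
  simp only [eval_mul, eval_C, eval_prod, eval_sub, eval_X]
  rw [mul_left_comm]
  congr 1
  have hc : n - 1 = ((Finset.range n).erase j).card := by simp [Finset.card_erase_of_mem hj]
  rw [hc, ← Finset.prod_const, ← Finset.prod_mul_distrib]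
  refine Finset.prod_congr rfl fun i _ => ?_
  field_simp

theorem one_sub_mul_geom (a : ℂ) :
    (1 - PowerSeries.C a * PowerSeries.X) * PowerSeries.mk (fun k => a ^ k) = 1 := by
  ext k
  cases k with
  | zero => simp [sub_mul, mul_assoc]
  | succ k =>
    rw [sub_mul, mul_assoc, map_sub, PowerSeries.coeff_C_mul, PowerSeries.coeff_succ_X_mul]
    simp [PowerSeries.coeff_one, pow_succ']

/-- The generating function of the power sums of a multiset. -/
noncomputable def powerSumSeries (s : Multiset ℂ) : PowerSeries ℂ :=
  PowerSeries.mk fun k => (s.map fun a => a ^ (k + 1)).sum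

/-- The power series `∏ (1 - a X)`, with `a` running through a multiset. -/
noncomputable def revProd (s : Multiset ℂ) : PowerSeries ℂ :=
  (s.map fun a => 1 - PowerSeries.C a * PowerSeries.X).prod

/-- Logarithmic differentiation: each factor contributes `-a / (1 - a X)`, whose geometric expansion
starts with `a`. This is the source of the exponent `k + 1` in `powerSumSeries`. -/
theorem derivative_revProd (s : Multiset ℂ) :
    PowerSeries.derivative ℂ (revProd s) = -(revProd s * powerSumSeries s) := by
  induction s using Multiset.induction_on with
  | empty =>
    have : powerSumSeries 0 = 0 := by ext k; simp [powerSumSeries]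
    simp [revProd, this]
  | cons a s ih =>
    have h1 : revProd (a ::ₘ s) = (1 - PowerSeries.C a * PowerSeries.X) * revProd s := by
      simp [revProd]
    have h2 : powerSumSeries (a ::ₘ s) =
        PowerSeries.C a * PowerSeries.mk (fun k => a ^ k) + powerSumSeries s := by
      ext k; simp [powerSumSeries, pow_succ']
    have h3 : PowerSeries.derivative ℂ (1 - PowerSeries.C a * PowerSeries.X) = -PowerSeries.C a := by
      simp
    rw [h1, h2, Derivation.leibniz, ih, h3, smul_eq_mul, smul_eq_mul]
    linear_combination (PowerSeries.C a * revProd s) * one_sub_mul_geom a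

theorem revProd_ne_zero (s : Multiset ℂ) : revProd s ≠ 0 := by
  intro h
  have : PowerSeries.constantCoeff (revProd s) = 1 := by
    simp [revProd, map_multiset_prod]
  simp [h] at this

/-- The generating function of the weighted power sums of the zeros. -/
noncomputable def weightedSeries (n : ℕ) (z lam : ℕ → ℂ) : PowerSeries ℂ :=
  PowerSeries.mk fun k => ∑ j ∈ Finset.range n, lam j * z j ^ k

theorem weightedSeries_eq : weightedSeries n z lam =
    ∑ j ∈ Finset.range n, PowerSeries.C (lam j) * PowerSeries.mk (fun k => z j ^ k) := by
  ext k
  simp [weightedSeries]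

/-- The reversed factorization as a formal identity: `weightedSeries` is `∑ λ_j / (1 - z_j X)`, and
multiplying by the full product cancels one factor in each summand. -/
theorem C_sum_mul_revProd_roots (h : ∑ j ∈ Finset.range n, lam j ≠ 0) :
    PowerSeries.C (∑ j ∈ Finset.range n, lam j) * revProd (genDeriv n z lam).roots =
      revProd ((Multiset.range n).map z) * weightedSeries n z lam := by
  have key : C (∑ j ∈ Finset.range n, lam j) *
      ((genDeriv n z lam).roots.map fun w => 1 - C w * X).prod =
      ∑ j ∈ Finset.range n, C (lam j) * ∏ i ∈ (Finset.range n).erase j, (1 - C (z i) * X) := by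
    refine Polynomial.funext fun y => ?_
    have := sum_mul_prod_one_sub_roots (z := z) h y
    simpa [eval_multiset_prod, eval_finsetSum, eval_prod] using this
  have key2 := congrArg (Polynomial.coeToPowerSeries.ringHom (R := ℂ)) key
  simp only [map_mul, map_multiset_prod, map_sum, map_prod, map_sub, map_one, Multiset.map_map,
    Polynomial.coeToPowerSeries.ringHom_apply, Function.comp_def, coe_C, coe_X] at key2
  rw [revProd, map_sum, key2, weightedSeries_eq, Finset.mul_sum]
  refine Finset.sum_congr rfl fun j hj => ?_
  have : revProd ((Multiset.range n).map z) = (1 - PowerSeries.C (z j) * PowerSeries.X) *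
      ∏ i ∈ (Finset.range n).erase j, (1 - PowerSeries.C (z i) * PowerSeries.X) := by
    rw [Finset.mul_prod_erase _ (fun i => 1 - PowerSeries.C (z i) * PowerSeries.X) hj, revProd,
      Multiset.map_map]
    rfl
  rw [this]
  linear_combination (-PowerSeries.C (lam j) *
    ∏ i ∈ (Finset.range n).erase j, (1 - PowerSeries.C (z i) * PowerSeries.X)) *
    one_sub_mul_geom (z j)

/-- The logarithmic derivative of the preceding factorization, in which the constant `∑ λ_j`
disappears. It plays the role of Newton's identities. -/
theorem weightedSeries_mul_powerSum_sub (h : ∑ j ∈ Finset.range n, lam j ≠ 0) :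
    weightedSeries n z lam * (powerSumSeries ((Multiset.range n).map z) -
      powerSumSeries (genDeriv n z lam).roots) =
      PowerSeries.derivative ℂ (weightedSeries n z lam) := by
  have h1 := C_sum_mul_revProd_roots (z := z) h
  have h2 := congrArg (PowerSeries.derivative ℂ) h1
  rw [Derivation.leibniz, Derivation.leibniz, derivative_revProd, derivative_revProd] at h2
  simp only [smul_eq_mul, PowerSeries.derivative_C, mul_zero, add_zero] at h2
  refine mul_left_cancel₀ (revProd_ne_zero ((Multiset.range n).map z)) ?_
  linear_combination powerSumSeries (genDeriv n z lam).roots * h1 + h2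

/-- The power sums of the zeros of the generalized derivative differ from those of the original
zeros by a quantity that is bounded independently of the degree. -/
theorem exists_powerSum_sub_le {K δ : ℝ} (hδ : 0 < δ) (k : ℕ) :
    ∃ B : ℝ, ∀ (n : ℕ) (z lam : ℕ → ℂ), 1 ≤ n → (∀ j, ‖z j‖ = 1) →
      ∑ j ∈ Finset.range n, ‖lam j‖ ≤ n * K → n * δ ≤ ‖∑ j ∈ Finset.range n, lam j‖ →
      ‖(∑ j ∈ Finset.range n, z j ^ (k + 1)) -
        ((genDeriv n z lam).roots.map fun w => w ^ (k + 1)).sum‖ ≤ B := by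
  induction k using Nat.strong_induction_on with
  | _ k ih =>
    choose! B hB using ih
    -- The coefficient of `X ^ k` gives a recursion for the `k`-th difference with leading factor `g
    -- 0 = ∑ λ_j`. The factor `n` in the bounds on all `g i` cancels, so the bound depends only on
    -- `K`, `δ` and `k`.
    refine ⟨((k + 1) * K + ∑ i ∈ Finset.range k, K * B i) / δ, fun n z lam hn hz hK hd => ?_⟩
    have hn' : (0 : ℝ) < n := by exact_mod_cast hn
    have hs : ∑ j ∈ Finset.range n, lam j ≠ 0 := by
      intro h0
      rw [h0, norm_zero] at hd
      nlinarith [mul_pos hn' hδ]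
    set d : ℕ → ℂ := fun k => (∑ j ∈ Finset.range n, z j ^ (k + 1)) -
        ((genDeriv n z lam).roots.map fun w => w ^ (k + 1)).sum with hdef
    set g : ℕ → ℂ := fun k => ∑ j ∈ Finset.range n, lam j * z j ^ k with hg
    have hgK : ∀ k, ‖g k‖ ≤ n * K := fun k => by
      refine (norm_sum_le _ _).trans (le_trans (le_of_eq ?_) hK)
      exact Finset.sum_congr rfl fun j _ => by simp [hz]
    have h1 := congrArg (PowerSeries.coeff k) (weightedSeries_mul_powerSum_sub (z := z) hs)
    rw [mul_comm, PowerSeries.coeff_mul, PowerSeries.coeff_derivative,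
      Finset.Nat.sum_antidiagonal_eq_sum_range_succ_mk, Finset.sum_range_succ] at h1
    have hd' : ∀ i, PowerSeries.coeff i (powerSumSeries ((Multiset.range n).map z) -
        powerSumSeries (genDeriv n z lam).roots) = d i := fun i => by
      simp [powerSumSeries, hdef, Finset.sum, Multiset.map_map]
    have hg' : ∀ i, PowerSeries.coeff i (weightedSeries n z lam) = g i := fun i => by
      simp [weightedSeries, hg]
    simp only [hd', hg', Nat.sub_self] at h1
    have h2 : d k * g 0 = g (k + 1) * (k + 1) - ∑ i ∈ Finset.range k, d i * g (k - i) := by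
      rw [← h1]; ring
    have h3 : ‖d k‖ * (n * δ) ≤ n * ((k + 1) * K + ∑ i ∈ Finset.range k, K * B i) := by
      calc ‖d k‖ * (n * δ) ≤ ‖d k‖ * ‖g 0‖ := by
            gcongr
            simpa [hg] using hd
        _ = ‖g (k + 1) * (k + 1) - ∑ i ∈ Finset.range k, d i * g (k - i)‖ := by rw [← norm_mul, h2]
        _ ≤ ‖g (k + 1) * (k + 1)‖ + ∑ i ∈ Finset.range k, ‖d i * g (k - i)‖ :=
            (norm_sub_le _ _).trans (by gcongr; exact norm_sum_le _ _)
        _ ≤ n * K * (k + 1) + ∑ i ∈ Finset.range k, B i * (n * K) := by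
            have hk : ‖(k + 1 : ℂ)‖ = k + 1 := by exact_mod_cast Complex.norm_natCast (k + 1)
            gcongr with i hi
            · rw [norm_mul, hk]
              gcongr
              exact hgK _
            · rw [norm_mul]
              have := hB i (Finset.mem_range.1 hi) n z lam hn hz hK hd
              exact mul_le_mul this (hgK _) (norm_nonneg _) ((norm_nonneg _).trans this)
        _ = n * ((k + 1) * K + ∑ i ∈ Finset.range k, K * B i) := by
            rw [mul_add (n : ℝ), Finset.mul_sum]
            congr 1
            · ring
            · exact Finset.sum_congr rfl fun i _ => by ring
    change ‖d k‖ ≤ _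
    rw [le_div_iff₀ hδ]
    refine le_of_mul_le_mul_left ?_ hn'
    linarith

end Algebra

/-! ### Jensen-type bounds for the zeros off the unit circle. -/

section ZeroCounting

/-- If `f = ∏ (w - a) * h` on a disk, then the number of the points `a` close to the centre is
controlled by the size of `f` at the centre and on the boundary. -/
theorem norm_center_mul_pow_le (s : Multiset ℂ) {c : ℂ} {R ρ B : ℝ} (hR : 0 < R) (hρ : 0 < ρ)
    {h : ℂ → ℂ} (hh : DiffContOnCl ℂ h (Metric.ball c R)) (hs : ∀ a ∈ s, ‖a - c‖ ≤ ρ)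
    (hB : ∀ w ∈ Metric.sphere c R, ‖(s.map fun a => w - a).prod * h w‖ ≤ B) :
    ‖(s.map fun a => c - a).prod * h c‖ * R ^ Multiset.card s ≤ B * ρ ^ Multiset.card s := by
  induction s using Multiset.induction_on generalizing h with
  | empty =>
    simp only [Multiset.map_zero, Multiset.prod_zero, one_mul, Multiset.card_zero, pow_zero,
      mul_one] at hB ⊢
    refine Complex.norm_le_of_forall_mem_frontier_norm_le Metric.isBounded_ball hh ?_
      (subset_closure (Metric.mem_ball_self hR))
    rwa [frontier_ball c hR.ne']
  | cons a s ih =>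
    -- A Blaschke-type replacement for `w - a`: it has the same modulus on the circle of radius `R`
    -- but the value `R` at the centre. Each exchange gains a factor `R / ‖a - c‖`, and the maximum
    -- principle finishes.
    set g : ℂ → ℂ := fun w => ((R : ℂ) ^ 2 - (starRingEnd ℂ) (a - c) * (w - c)) / R with hg
    have hgd : DiffContOnCl ℂ g (Metric.ball c R) :=
      Differentiable.diffContOnCl (by fun_prop)
    have hRC : (R : ℂ) ≠ 0 := by exact_mod_cast hR.ne'
    have hnorm : ∀ w ∈ Metric.sphere c R, ‖g w‖ = ‖w - a‖ := by
      intro w hw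
      have hw' : ‖w - c‖ = R := by simpa [dist_eq_norm] using hw
      have h1 : (R : ℂ) ^ 2 - (starRingEnd ℂ) (a - c) * (w - c) =
          (starRingEnd ℂ) (w - a) * (w - c) := by
        have h2 := Complex.conj_mul' (w - c)
        rw [hw'] at h2
        rw [← h2, ← sub_mul, ← map_sub]
        congr 2
        ring
      rw [hg]
      simp only
      rw [h1, norm_div, norm_mul, RCLike.norm_conj, hw', Complex.norm_real, Real.norm_eq_abs,
        abs_of_pos hR]
      field_simp
    have key := ih (h := fun w => g w * h w) (hgd.smul hh)
      (fun b hb => hs b (Multiset.mem_cons_of_mem hb)) (by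
        intro w hw
        refine le_trans (le_of_eq ?_) (hB w hw)
        simp only [Multiset.map_cons, Multiset.prod_cons, norm_mul, hnorm w hw]
        ring)
    have hgc : g c = R := by
      simp only [hg, sub_self, mul_zero, sub_zero]
      field_simp
    have ha : ‖c - a‖ ≤ ρ := by
      rw [norm_sub_rev]
      exact hs a (Multiset.mem_cons_self a s)
    simp only [hgc, norm_mul, Complex.norm_real, Real.norm_eq_abs, abs_of_pos hR] at key
    simp only [Multiset.map_cons, Multiset.prod_cons, Multiset.card_cons, norm_mul, pow_succ]
    calc ‖c - a‖ * ‖(s.map fun a => c - a).prod‖ * ‖h c‖ * (R ^ Multiset.card s * R)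
        = ‖c - a‖ * (‖(s.map fun a => c - a).prod‖ * (R * ‖h c‖) * R ^ Multiset.card s) := by ring
      _ ≤ ρ * (B * ρ ^ Multiset.card s) := by
          refine mul_le_mul ha key (by positivity) hρ.le
      _ = B * (ρ ^ Multiset.card s * ρ) := by ring

theorem exists_nat_bound_of_pow_le {a R ρ : ℝ} (B : ℝ) (ha : 0 < a) (hρ : 0 < ρ) (hR : ρ < R) :
    ∃ N : ℕ, ∀ k : ℕ, a * R ^ k ≤ B * ρ ^ k → k ≤ N := by
  obtain ⟨N, hN⟩ := pow_unbounded_of_one_lt (B / a) ((one_lt_div hρ).2 hR)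
  refine ⟨N, fun k hk => ?_⟩
  by_contra! hlt
  have h1 : (R / ρ) ^ k ≤ B / a := by
    rw [div_pow, div_le_div_iff₀ (by positivity) ha]
    linarith
  have h2 : (R / ρ) ^ N ≤ (R / ρ) ^ k :=
    pow_le_pow_right₀ ((one_lt_div hρ).2 hR).le hlt.le
  linarith

theorem differentiable_multiset_prod {ι : Type*} (s : Multiset ι) (f : ι → ℂ → ℂ)
    (hf : ∀ i, Differentiable ℂ (f i)) : Differentiable ℂ fun w => (s.map fun i => f i w).prod := by
  induction s using Multiset.induction_on with
  | empty => simp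
  | cons a s ih =>
    simp only [Multiset.map_cons, Multiset.prod_cons]
    exact (hf a).mul ih

theorem norm_sum_div_le {n : ℕ} {lam v : ℕ → ℂ} {K r : ℝ} (hr : 0 < r)
    (hK : ∑ j ∈ Finset.range n, ‖lam j‖ ≤ n * K) (hv : ∀ j, r ≤ ‖v j‖) :
    ‖∑ j ∈ Finset.range n, lam j / v j‖ ≤ n * K / r := by
  calc ‖∑ j ∈ Finset.range n, lam j / v j‖ ≤ ∑ j ∈ Finset.range n, ‖lam j / v j‖ := norm_sum_le _ _
    _ ≤ ∑ j ∈ Finset.range n, ‖lam j‖ / r := by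
        refine Finset.sum_le_sum fun j _ => ?_
        rw [norm_div]
        have := hv j
        gcongr
    _ ≤ n * K / r := by rw [← Finset.sum_div]; gcongr

theorem sum_ne_zero_of_le_norm {n : ℕ} {lam : ℕ → ℂ} {δ : ℝ} (hδ : 0 < δ) (hn : 1 ≤ n)
    (hd : n * δ ≤ ‖∑ j ∈ Finset.range n, lam j‖) : ∑ j ∈ Finset.range n, lam j ≠ 0 := by
  have hn' : (0 : ℝ) < n := by exact_mod_cast hn
  intro h0
  rw [h0, norm_zero] at hd
  nlinarith [mul_pos hn' hδ]

/-- The number of zeros of a generalized derivative away from the closed unit disk is bounded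
independently of the degree. -/
theorem exists_card_roots_outer_le (K : ℝ) {δ ε : ℝ} (hδ : 0 < δ) (hε : 0 < ε) :
    ∃ N : ℕ, ∀ (n : ℕ) (z lam : ℕ → ℂ), 1 ≤ n → (∀ j, ‖z j‖ = 1) →
      ∑ j ∈ Finset.range n, ‖lam j‖ ≤ n * K → n * δ ≤ ‖∑ j ∈ Finset.range n, lam j‖ →
      Multiset.card ((genDeriv n z lam).roots.filter fun w => 1 + ε ≤ ‖w‖) ≤ N := by
  -- In the coordinate `y = 1 / w` the outer zeros lie in the disk of radius `ρ < 1`; the comparison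
  -- circle is halfway between it and the unit circle, where the poles are.
  set ρ : ℝ := (1 + ε)⁻¹ with hρ
  have hρ0 : 0 < ρ := by positivity
  have hρ1 : ρ < 1 := inv_lt_one_of_one_lt₀ (by linarith)
  set R : ℝ := (ρ + 1) / 2 with hR
  have hR1 : R < 1 := by linarith
  have hρR : ρ < R := by linarith
  obtain ⟨N, hN⟩ := exists_nat_bound_of_pow_le (K / (1 - R)) hδ hρ0 hρR
  refine ⟨N, fun n z lam hn hz hK hd => hN _ ?_⟩
  have hn' : (0 : ℝ) < n := by exact_mod_cast hn
  have hs := sum_ne_zero_of_le_norm hδ hn hd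
  set W := (genDeriv n z lam).roots with hW
  set S := W.filter fun w => 1 + ε ≤ ‖w‖ with hS
  set T := W.filter fun w => ¬ (1 + ε ≤ ‖w‖) with hT
  have hST : S + T = W := Multiset.filter_add_not _ _
  have hS' : ∀ w ∈ S, 1 + ε ≤ ‖w‖ := fun w hw => (Multiset.mem_filter.1 hw).2
  -- Since `1 - w y = (y - w⁻¹) (-w)`, splitting off the zeros `w⁻¹` leaves the constants `-w` in
  -- the holomorphic cofactor.
  set h : ℂ → ℂ := fun y => (∑ j ∈ Finset.range n, lam j) * (S.map fun w => -w).prod *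
    (T.map fun w => 1 - w * y).prod / ∏ j ∈ Finset.range n, (1 - z j * y) with hh
  have hden : ∀ y : ℂ, ‖y‖ < 1 → ∀ j, 1 - ‖y‖ ≤ ‖1 - z j * y‖ := by
    intro y hy j
    have := norm_sub_norm_le (1 : ℂ) (z j * y)
    rwa [norm_one, norm_mul, hz, one_mul] at this
  have hden0 : ∀ y : ℂ, ‖y‖ < 1 → ∀ j, 1 - z j * y ≠ 0 := fun y hy j =>
    norm_pos_iff.1 ((sub_pos.2 hy).trans_le (hden y hy j))
  have hprod : ∀ y : ℂ, ‖y‖ < 1 → ((S.map fun w => w⁻¹).map fun a => y - a).prod * h y =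
      ∑ j ∈ Finset.range n, lam j / (1 - z j * y) := by
    intro y hy
    have h1 := sum_mul_prod_one_sub_roots (z := z) hs y
    rw [← hW, ← hST, Multiset.map_add, Multiset.prod_add] at h1
    have h2 : (S.map fun w => 1 - w * y).prod =
        ((S.map fun w => w⁻¹).map fun a => y - a).prod * (S.map fun w => -w).prod := by
      rw [Multiset.map_map, ← Multiset.prod_map_mul]
      refine congrArg Multiset.prod (Multiset.map_congr rfl fun w hw => ?_)
      have : w ≠ 0 := norm_pos_iff.1 (by linarith [hS' w hw])
      simp only [Function.comp_apply]
      field_simp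
      ring
    have h3 : ∏ j ∈ Finset.range n, (1 - z j * y) ≠ 0 :=
      Finset.prod_ne_zero_iff.2 fun j _ => hden0 y hy j
    rw [hh, mul_div_assoc', div_eq_iff h3]
    calc _ = (∑ j ∈ Finset.range n, lam j) *
          ((S.map fun w => 1 - w * y).prod * (T.map fun w => 1 - w * y).prod) := by rw [h2]; ring
      _ = _ := h1
      _ = _ := by
        rw [Finset.sum_mul]
        refine Finset.sum_congr rfl fun j hj => ?_
        rw [← Finset.mul_prod_erase _ _ hj, ← mul_assoc, div_mul_cancel₀ _ (hden0 y hy j)]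
  have hdiff : DiffContOnCl ℂ h (Metric.ball 0 R) := by
    refine DifferentiableOn.diffContOnCl_ball (U := Metric.ball 0 1) ?_
      (Metric.closedBall_subset_ball hR1)
    intro y hy
    refine DifferentiableAt.differentiableWithinAt ?_
    refine DifferentiableAt.div ?_ (by fun_prop)
      (Finset.prod_ne_zero_iff.2 fun j _ => hden0 y (by simpa using hy) j)
    refine ((differentiable_multiset_prod T (fun w y => 1 - w * y) ?_).const_mul _) y
    fun_prop
  have key := norm_center_mul_pow_le (S.map fun w => w⁻¹) (c := 0) (R := R) (ρ := ρ)
    (B := n * K / (1 - R)) (hρ0.trans hρR) hρ0 hdiff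
    (by
      intro a ha
      obtain ⟨w, hw, rfl⟩ := Multiset.mem_map.1 ha
      rw [sub_zero, norm_inv]
      exact inv_anti₀ (by positivity) (hS' w hw))
    (by
      intro y hy
      have hy' : ‖y‖ = R := by simpa using hy
      rw [hprod y (hy' ▸ hR1)]
      refine norm_sum_div_le (by linarith) hK fun j => ?_
      rw [← hy']
      exact hden y (hy' ▸ hR1) j)
  rw [hprod 0 (by simp), Multiset.card_map] at key
  simp only [mul_zero, sub_zero, div_one] at key
  refine le_of_mul_le_mul_left ?_ hn'
  calc (n : ℝ) * (δ * R ^ Multiset.card S) = n * δ * R ^ Multiset.card S := by ring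
    _ ≤ ‖∑ j ∈ Finset.range n, lam j‖ * R ^ Multiset.card S := by
        have : 0 < R := hρ0.trans hρR
        gcongr
    _ ≤ _ := key
    _ = _ := by ring

/-- The number of zeros of a generalized derivative in a disk of radius less than `1` is bounded
independently of the degree, if the logarithmic derivative is bounded below at a point close to
the origin. -/
theorem exists_card_roots_inner_le (K : ℝ) {η ε : ℝ} (hη : 0 < η) (hε : 0 < ε) (hε1 : ε < 1) :
    ∃ N : ℕ, ∀ (n : ℕ) (z lam : ℕ → ℂ) (x : ℂ), 1 ≤ n → (∀ j, ‖z j‖ = 1) →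
      ∑ j ∈ Finset.range n, lam j ≠ 0 →
      ∑ j ∈ Finset.range n, ‖lam j‖ ≤ n * K → ‖x‖ ≤ ε / 4 →
      n * η ≤ ‖∑ j ∈ Finset.range n, lam j / (x - z j)‖ →
      Multiset.card ((genDeriv n z lam).roots.filter fun w => ‖w‖ ≤ 1 - ε) ≤ N := by
  -- As `‖x‖ ≤ ε / 4`, the inner zeros lie within `ρ` of `x`, while the circle of radius `R = 1 - ε
  -- / 2` about `x` stays at distance at least `ε / 4` from the poles.
  set ρ : ℝ := 1 - 3 * ε / 4 with hρ
  have hρ0 : 0 < ρ := by linarith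
  set R : ℝ := 1 - ε / 2 with hR
  have hρR : ρ < R := by linarith
  obtain ⟨N, hN⟩ := exists_nat_bound_of_pow_le (K / (ε / 4)) hη hρ0 hρR
  refine ⟨N, fun n z lam x hn hz hs hK hx hd => hN _ ?_⟩
  have hn' : (0 : ℝ) < n := by exact_mod_cast hn
  set W := (genDeriv n z lam).roots with hW
  set S := W.filter fun w => ‖w‖ ≤ 1 - ε with hS
  set T := W.filter fun w => ¬ (‖w‖ ≤ 1 - ε) with hT
  have hST : S + T = W := Multiset.filter_add_not _ _
  have hS' : ∀ w ∈ S, ‖w‖ ≤ 1 - ε := fun w hw => (Multiset.mem_filter.1 hw).2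
  set h : ℂ → ℂ := fun y => (∑ j ∈ Finset.range n, lam j) *
    (T.map fun w => y - w).prod / ∏ j ∈ Finset.range n, (y - z j) with hh
  have hden : ∀ y : ℂ, ∀ j, 1 - ‖y‖ ≤ ‖y - z j‖ := by
    intro y j
    have := norm_sub_norm_le (z j) y
    rwa [hz, norm_sub_rev] at this
  have hden0 : ∀ y : ℂ, ‖y‖ < 1 → ∀ j, y - z j ≠ 0 := fun y hy j =>
    norm_pos_iff.1 ((sub_pos.2 hy).trans_le (hden y j))
  have hprod : ∀ y : ℂ, ‖y‖ < 1 → (S.map fun w => y - w).prod * h y =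
      ∑ j ∈ Finset.range n, lam j / (y - z j) := by
    intro y hy
    have h1 := eval_genDeriv_eq_prod_roots (z := z) hs y
    rw [← hW, ← hST, Multiset.map_add, Multiset.prod_add,
      eval_genDeriv n z lam y (fun j _ => sub_ne_zero.1 (hden0 y hy j))] at h1
    have h3 : ∏ j ∈ Finset.range n, (y - z j) ≠ 0 :=
      Finset.prod_ne_zero_iff.2 fun j _ => hden0 y hy j
    have h4 : (polyOfZeros n z).eval y = ∏ j ∈ Finset.range n, (y - z j) := by
      simp [polyOfZeros, eval_prod]
    rw [hh, mul_div_assoc', div_eq_iff h3, ← h4]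
    linear_combination -h1
  have hball : Metric.closedBall x R ⊆ Metric.ball (0 : ℂ) 1 :=
    Metric.closedBall_subset_ball' (by rw [dist_zero_right]; linarith)
  have hdiff : DiffContOnCl ℂ h (Metric.ball x R) := by
    refine DifferentiableOn.diffContOnCl_ball (U := Metric.ball 0 1) ?_ hball
    intro y hy
    refine DifferentiableAt.differentiableWithinAt ?_
    refine DifferentiableAt.div ?_ (by fun_prop)
      (Finset.prod_ne_zero_iff.2 fun j _ => hden0 y (by simpa using hy) j)
    refine ((differentiable_multiset_prod T (fun w y => y - w) ?_).const_mul _) y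
    fun_prop
  have key := norm_center_mul_pow_le S (c := x) (R := R) (ρ := ρ)
    (B := n * K / (ε / 4)) (hρ0.trans hρR) hρ0 hdiff
    (by
      intro w hw
      have := norm_sub_le w x
      linarith [hS' w hw])
    (by
      intro y hy
      have hy' : ‖y - x‖ = R := by simpa [dist_eq_norm] using hy
      have hy2 : ‖y‖ ≤ 1 - ε / 4 := by
        have := norm_le_norm_add_norm_sub x y
        rw [norm_sub_rev] at this
        linarith
      rw [hprod y (by linarith)]
      refine norm_sum_div_le (by linarith) hK fun j => ?_
      linarith [hden y j])
  rw [hprod x (by linarith)] at key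
  refine le_of_mul_le_mul_left ?_ hn'
  calc (n : ℝ) * (η * R ^ Multiset.card S) = n * η * R ^ Multiset.card S := by ring
    _ ≤ ‖∑ j ∈ Finset.range n, lam j / (x - z j)‖ * R ^ Multiset.card S := by
        have : 0 < R := hρ0.trans hρR
        gcongr
    _ ≤ _ := key
    _ = _ := by ring

/-- The zeros of a generalized derivative are bounded independently of the degree. -/
theorem norm_le_of_mem_roots_genDeriv {K δ : ℝ} (hδ : 0 < δ) {n : ℕ} {z lam : ℕ → ℂ} (hn : 1 ≤ n)
    (hz : ∀ j, ‖z j‖ = 1) (hK : ∑ j ∈ Finset.range n, ‖lam j‖ ≤ n * K)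
    (hd : n * δ ≤ ‖∑ j ∈ Finset.range n, lam j‖) {w : ℂ} (hw : w ∈ (genDeriv n z lam).roots) :
    ‖w‖ ≤ 1 + K / δ := by
  have hn' : (0 : ℝ) < n := by exact_mod_cast hn
  have hK0 : 0 ≤ K := by
    have : 0 ≤ (n : ℝ) * K := (Finset.sum_nonneg fun j _ => norm_nonneg (lam j)).trans hK
    exact nonneg_of_mul_nonneg_right this hn'
  by_contra! hlt
  have hw1 : 1 < ‖w‖ := lt_of_le_of_lt (by have := div_nonneg hK0 hδ.le; linarith) hlt
  have hden : ∀ j, ‖w‖ - 1 ≤ ‖w - z j‖ := fun j => by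
    have := norm_sub_norm_le w (z j)
    rwa [hz] at this
  have hden0 : ∀ j, w - z j ≠ 0 := fun j => norm_pos_iff.1 ((sub_pos.2 hw1).trans_le (hden j))
  have hroot : (genDeriv n z lam).eval w = 0 := (mem_roots'.1 hw).2
  rw [eval_genDeriv n z lam w (fun j _ => sub_ne_zero.1 (hden0 j))] at hroot
  have hP : (polyOfZeros n z).eval w ≠ 0 := by
    simp only [polyOfZeros, eval_prod, eval_sub, eval_X, eval_C]
    exact Finset.prod_ne_zero_iff.2 fun j _ => hden0 j
  have h0 := (mul_eq_zero.1 hroot).resolve_left hP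
  -- At a zero `w`, multiply `∑ λ_j / (w - z_j) = 0` by `w` and use `w / (w - z) = 1 + z / (w - z)`.
  -- A large `‖w‖` would make the right side too small for the lower bound `n δ`.
  have h1 : ∑ j ∈ Finset.range n, lam j = -∑ j ∈ Finset.range n, lam j * z j / (w - z j) := by
    have h2 : w * ∑ j ∈ Finset.range n, lam j / (w - z j) = ∑ j ∈ Finset.range n, lam j +
        ∑ j ∈ Finset.range n, lam j * z j / (w - z j) := by
      rw [Finset.mul_sum, ← Finset.sum_add_distrib]
      refine Finset.sum_congr rfl fun j _ => ?_
      have := hden0 j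
      field_simp
      ring
    rw [h0, mul_zero] at h2
    exact eq_neg_of_add_eq_zero_left h2.symm
  have h2 : ‖∑ j ∈ Finset.range n, lam j‖ ≤ n * K / (‖w‖ - 1) := by
    rw [h1, norm_neg]
    refine norm_sum_div_le (lam := fun j => lam j * z j) (by linarith) ?_ hden
    simpa [hz] using hK
  have h3 : n * δ * (‖w‖ - 1) ≤ n * K := (le_div_iff₀ (by linarith)).1 (hd.trans h2)
  have h4 : δ * (‖w‖ - 1) ≤ K := le_of_mul_le_mul_left (by linarith) hn'
  have h5 : K < (‖w‖ - 1) * δ := (div_lt_iff₀ hδ).1 (by linarith)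
  linarith

end ZeroCounting

/-! ### A point near the origin where the logarithmic derivative is large. -/

section LowerBound

/-- A finite geometric sum with exact remainder, using `a⁻¹ = conj a` on the circle. The conjugates
explain the form of the coefficients in condition (i). -/
theorem one_div_sub_eq_geom {x a : ℂ} (ha : ‖a‖ = 1) (hx : ‖x‖ < 1) (m : ℕ) :
    1 / (x - a) = -∑ k ∈ Finset.range (m + 1), x ^ k * (starRingEnd ℂ) a ^ (k + 1) +
      x ^ (m + 1) * (starRingEnd ℂ) a ^ (m + 1) / (x - a) := by
  have hxa : x - a ≠ 0 := by
    intro h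
    rw [sub_eq_zero.1 h, ha] at hx
    exact lt_irrefl _ hx
  have haa : (starRingEnd ℂ) a * a = 1 := by rw [Complex.conj_mul', ha]; norm_num
  have hg := mul_neg_geom_sum (x * (starRingEnd ℂ) a) (m + 1)
  have h1 : ∑ k ∈ Finset.range (m + 1), x ^ k * (starRingEnd ℂ) a ^ (k + 1) =
      (starRingEnd ℂ) a * ∑ k ∈ Finset.range (m + 1), (x * (starRingEnd ℂ) a) ^ k := by
    rw [Finset.mul_sum]
    exact Finset.sum_congr rfl fun k _ => by rw [mul_pow]; ring
  rw [h1]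
  field_simp
  rw [mul_pow] at hg
  linear_combination -hg + (-∑ k ∈ Finset.range (m + 1), (x * (starRingEnd ℂ) a) ^ k) * haa

/-- If the coefficients of the logarithmic derivatives `(1/n) ∑ lam n j / (x - z j)` at the origin
converge, and not all limits vanish, then these functions are bounded below at some point near the
origin. -/
theorem exists_lower_bound_near_zero {z : ℕ → ℂ} (hz : ∀ j, ‖z j‖ = 1) {lam : ℕ → ℕ → ℂ} {K : ℝ}
    (hK : ∀ n ≥ 2, ∑ j ∈ Finset.range n, ‖lam n j‖ ≤ n * K) {b : ℕ → ℂ} (hb : ∃ m, b m ≠ 0)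
    (hlim : ∀ m, Tendsto (fun n : ℕ => (1 / (n : ℂ)) *
      ∑ j ∈ Finset.range n, (starRingEnd ℂ) (lam n j) * z j ^ (m + 1)) atTop (𝓝 (b m)))
    {r : ℝ} (hr : 0 < r) :
    ∃ x : ℂ, ‖x‖ ≤ r ∧ ∃ η : ℝ, 0 < η ∧
      ∀ᶠ n : ℕ in atTop, n * η ≤ ‖∑ j ∈ Finset.range n, lam n j / (x - z j)‖ := by
  -- Take the first nonvanishing limit `b m`: near `0` the term of order `t ^ m` then dominates, as
  -- the earlier coefficients tend to `0` and the remainder is of order `t ^ (m + 1)`.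
  classical
  obtain ⟨m, hm, hmin⟩ : ∃ m, b m ≠ 0 ∧ ∀ k < m, b k = 0 :=
    ⟨Nat.find hb, Nat.find_spec hb, fun k hk => not_not.1 (Nat.find_min hb hk)⟩
  have hbm : 0 < ‖b m‖ := norm_pos_iff.2 hm
  have hK0 : 0 ≤ K := by
    have := (Finset.sum_nonneg fun j _ => norm_nonneg (lam 2 j)).trans (hK 2 le_rfl)
    norm_num at this
    exact this
  obtain ⟨t, ht0, htr, ht2, htK⟩ :
      ∃ t : ℝ, 0 < t ∧ t ≤ r ∧ t ≤ 1 / 2 ∧ 2 * K * t ≤ ‖b m‖ / 4 := by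
    -- The bound `1 / 2` keeps `t` away from the poles; `K + 1` instead of `K` avoids a zero
    -- denominator.
    refine ⟨min r (min (1 / 2) (‖b m‖ / (8 * (K + 1)))), by positivity, min_le_left _ _,
      (min_le_right _ _).trans (min_le_left _ _), ?_⟩
    have h1 : min r (min (1 / 2) (‖b m‖ / (8 * (K + 1)))) ≤ ‖b m‖ / (8 * (K + 1)) :=
      (min_le_right _ _).trans (min_le_right _ _)
    calc 2 * K * min r (min (1 / 2) (‖b m‖ / (8 * (K + 1))))
        ≤ 2 * (K + 1) * (‖b m‖ / (8 * (K + 1))) := by gcongr; linarith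
      _ = ‖b m‖ / 4 := by field_simp; norm_num
  have htn : ‖(t : ℂ)‖ = t := by rw [Complex.norm_real, Real.norm_eq_abs, abs_of_pos ht0]
  set a : ℕ → ℕ → ℂ := fun n k => (1 / (n : ℂ)) *
    ∑ j ∈ Finset.range n, (starRingEnd ℂ) (lam n j) * z j ^ (k + 1) with ha
  have hlow : Tendsto (fun n => ∑ k ∈ Finset.range m, t ^ k * ‖a n k‖) atTop (𝓝 0) := by
    have : Tendsto (fun n => ∑ k ∈ Finset.range m, t ^ k * ‖a n k‖) atTop
        (𝓝 (∑ k ∈ Finset.range m, t ^ k * ‖b k‖)) :=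
      tendsto_finsetSum _ fun k _ => (hlim k).norm.const_mul _
    rwa [Finset.sum_eq_zero fun k hk => by simp [hmin k (Finset.mem_range.1 hk)]] at this
  have hη : 0 < t ^ m * ‖b m‖ / 4 := by positivity
  -- After division by `n * t ^ m * ‖b m‖`: the main term is at least `3 / 4`, and the lower-order
  -- terms and the remainder cost at most `1 / 4` each.
  refine ⟨t, htn.le.trans htr, t ^ m * ‖b m‖ / 4, hη, ?_⟩
  filter_upwards [hlow.eventually (gt_mem_nhds hη),
    (hlim m).norm.eventually (lt_mem_nhds (show 3 / 4 * ‖b m‖ < ‖b m‖ by linarith)),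
    eventually_ge_atTop 2] with n h1 h2 hn
  have hn' : (0 : ℝ) < n := by exact_mod_cast (by omega : 0 < n)
  have hn0 : (n : ℂ) ≠ 0 := by exact_mod_cast hn'.ne'
  have hden : ∀ j, 1 / 2 ≤ ‖(t : ℂ) - z j‖ := fun j => by
    have := norm_sub_norm_le (z j) t
    rw [hz, norm_sub_rev, htn] at this
    linarith
  have hexp : ∑ j ∈ Finset.range n, lam n j / (t - z j) =
      -(n * ∑ k ∈ Finset.range (m + 1), (t : ℂ) ^ k * (starRingEnd ℂ) (a n k)) +
      t ^ (m + 1) * ∑ j ∈ Finset.range n,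
        lam n j * (starRingEnd ℂ) (z j) ^ (m + 1) / (t - z j) := by
    have h3 : ∀ k, (n : ℂ) * (starRingEnd ℂ) (a n k) =
        ∑ j ∈ Finset.range n, lam n j * (starRingEnd ℂ) (z j) ^ (k + 1) := fun k => by
      simp only [ha, map_mul, map_div₀, map_one, map_natCast, map_sum, map_pow, Complex.conj_conj]
      field_simp
    have h4 : (n : ℂ) * ∑ k ∈ Finset.range (m + 1), (t : ℂ) ^ k * (starRingEnd ℂ) (a n k) =
        ∑ j ∈ Finset.range n, lam n j *
          ∑ k ∈ Finset.range (m + 1), (t : ℂ) ^ k * (starRingEnd ℂ) (z j) ^ (k + 1) := by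
      rw [Finset.mul_sum]
      simp_rw [mul_left_comm (n : ℂ), h3, Finset.mul_sum]
      rw [Finset.sum_comm]
      exact Finset.sum_congr rfl fun j _ => Finset.sum_congr rfl fun k _ => by ring
    rw [h4, Finset.mul_sum, ← Finset.sum_neg_distrib, ← Finset.sum_add_distrib]
    refine Finset.sum_congr rfl fun j _ => ?_
    rw [div_eq_mul_one_div, one_div_sub_eq_geom (hz j) (by rw [htn]; linarith) m]
    ring
  have htail : ‖(t : ℂ) ^ (m + 1) * ∑ j ∈ Finset.range n,
        lam n j * (starRingEnd ℂ) (z j) ^ (m + 1) / (t - z j)‖ ≤ n * (t ^ m * ‖b m‖ / 4) := by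
    rw [norm_mul, norm_pow, htn]
    have := norm_sum_div_le (lam := fun j => lam n j * (starRingEnd ℂ) (z j) ^ (m + 1))
      (v := fun j => (t : ℂ) - z j) (n := n) (K := K) (r := 1 / 2) (by norm_num)
      (by simpa [hz] using hK n hn) hden
    calc _ ≤ t ^ (m + 1) * (n * K / (1 / 2)) := by gcongr
      _ = n * (t ^ m * (2 * K * t)) := by ring
      _ ≤ n * (t ^ m * (‖b m‖ / 4)) := by gcongr
      _ = _ := by ring
  have hmain : n * (t ^ m * ‖b m‖ / 2) ≤
      ‖(n : ℂ) * ∑ k ∈ Finset.range (m + 1), (t : ℂ) ^ k * (starRingEnd ℂ) (a n k)‖ := by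
    rw [norm_mul, Complex.norm_natCast, Finset.sum_range_succ]
    gcongr
    have h5 : ‖∑ k ∈ Finset.range m, (t : ℂ) ^ k * (starRingEnd ℂ) (a n k)‖ ≤
        ∑ k ∈ Finset.range m, t ^ k * ‖a n k‖ := by
      refine (norm_sum_le _ _).trans (le_of_eq (Finset.sum_congr rfl fun k _ => ?_))
      rw [norm_mul, norm_pow, htn, RCLike.norm_conj]
    have h6 : t ^ m * (3 / 4 * ‖b m‖) ≤ ‖(t : ℂ) ^ m * (starRingEnd ℂ) (a n m)‖ := by
      rw [norm_mul, norm_pow, htn, RCLike.norm_conj]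
      gcongr
    have h7 := norm_sub_le (∑ k ∈ Finset.range m, (t : ℂ) ^ k * (starRingEnd ℂ) (a n k) +
      (t : ℂ) ^ m * (starRingEnd ℂ) (a n m))
      (∑ k ∈ Finset.range m, (t : ℂ) ^ k * (starRingEnd ℂ) (a n k))
    rw [add_sub_cancel_left] at h7
    linarith
  have h8 := norm_sub_le (∑ j ∈ Finset.range n, lam n j / (t - z j))
    ((t : ℂ) ^ (m + 1) * ∑ j ∈ Finset.range n,
        lam n j * (starRingEnd ℂ) (z j) ^ (m + 1) / (t - z j))
  rw [hexp, add_sub_cancel_right, norm_neg, ← hexp] at h8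
  linarith

end LowerBound

/-! ### Trigonometric approximation and moments of measures on the circle. -/

section TrigApproximation

/-- Functions on the unit circle are uniformly approximated by polynomials in `w` and `conj w`. -/
theorem exists_trigPoly_approx {g : ℂ → ℂ} (hg : Continuous g) {ε : ℝ} (hε : 0 < ε) :
    ∃ p q : ℂ[X], ∀ w : ℂ, ‖w‖ = 1 → ‖g w - (p.eval w + (starRingEnd ℂ) (q.eval w))‖ ≤ ε := by
  let f : C(AddCircle (1 : ℝ), ℂ) :=
    ⟨fun x => g (AddCircle.toCircle x),
      hg.comp (continuous_subtype_val.comp AddCircle.continuous_toCircle)⟩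
  have hf : f ∈ closure (Submodule.span ℂ (Set.range (@fourier (1 : ℝ))) :
      Set C(AddCircle (1 : ℝ), ℂ)) := by
    rw [← Submodule.topologicalClosure_coe, span_fourier_closure_eq_top]
    trivial
  obtain ⟨φ, hφ, hd⟩ := Metric.mem_closure_iff.1 hf ε hε
  have hspan : ∃ p q : ℂ[X], ∀ x : AddCircle (1 : ℝ),
      φ x = p.eval (AddCircle.toCircle x : ℂ) +
        (starRingEnd ℂ) (q.eval (AddCircle.toCircle x : ℂ)) := by
    clear hd
    have hφ' : φ ∈ Submodule.span ℂ (Set.range (@fourier (1 : ℝ))) := hφ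
    clear hφ
    induction hφ' using Submodule.span_induction with
    | mem φ h =>
      obtain ⟨k, rfl⟩ := h
      obtain ⟨k, rfl | rfl⟩ := k.eq_nat_or_neg
      · refine ⟨X ^ k, 0, fun x => ?_⟩
        simp [fourier_apply, AddCircle.toCircle_nsmul]
      · refine ⟨0, X ^ k, fun x => ?_⟩
        rw [fourier_neg]
        simp [fourier_apply, AddCircle.toCircle_nsmul]
    | zero => exact ⟨0, 0, fun x => by simp⟩
    | add φ ψ _ _ h1 h2 =>
      obtain ⟨p, q, h⟩ := h1
      obtain ⟨p', q', h'⟩ := h2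
      refine ⟨p + p', q + q', fun x => ?_⟩
      simp only [ContinuousMap.add_apply, h, h', eval_add, map_add]
      ring
    | smul c φ _ h1 =>
      obtain ⟨p, q, h⟩ := h1
      -- The second polynomial enters conjugated, so its scalar must be conjugated too.
      refine ⟨C c * p, C ((starRingEnd ℂ) c) * q, fun x => ?_⟩
      simp only [ContinuousMap.smul_apply, h, eval_mul, eval_C, map_mul, Complex.conj_conj,
        smul_eq_mul]
      ring
  obtain ⟨p, q, hpq⟩ := hspan
  refine ⟨p, q, fun w hw => ?_⟩
  obtain ⟨x, hx⟩ := (AddCircle.homeomorphCircle (one_ne_zero (α := ℝ))).surjective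
    ⟨w, mem_sphere_zero_iff_norm.2 hw⟩
  rw [AddCircle.homeomorphCircle_apply] at hx
  have hx' : (AddCircle.toCircle x : ℂ) = w := by rw [hx]
  have h1 := (ContinuousMap.dist_apply_le_dist (f := f) (g := φ) x).trans hd.le
  rw [hpq, dist_eq_norm, hx'] at h1
  simpa [f, hx'] using h1

theorem integrable_of_continuous_of_circle {μ : Measure ℂ} [IsFiniteMeasure μ]
    (hμ : ∀ᵐ w ∂μ, ‖w‖ = 1) {E : Type*} [NormedAddCommGroup E] [SecondCountableTopology E]
    {g : ℂ → E} (hg : Continuous g) : Integrable g μ := by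
  obtain ⟨B, hB⟩ := (isCompact_sphere (0 : ℂ) 1).exists_bound_of_continuousOn hg.continuousOn
  refine Integrable.of_bound hg.aestronglyMeasurable B ?_
  filter_upwards [hμ] with w hw
  exact hB w (mem_sphere_zero_iff_norm.2 hw)

theorem integral_eval_polynomial {μ : Measure ℂ} [IsProbabilityMeasure μ]
    (hμ : ∀ᵐ w ∂μ, ‖w‖ = 1) (p : ℂ[X]) :
    ∫ w, p.eval w ∂μ = p.coeff 0 +
      ∑ k ∈ Finset.range p.natDegree, p.coeff (k + 1) * ∫ w, w ^ (k + 1) ∂μ := by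
  simp_rw [eval_eq_sum_range]
  rw [integral_finsetSum _ fun k _ =>
    integrable_of_continuous_of_circle hμ (by fun_prop), Finset.sum_range_succ']
  simp [integral_const_mul, add_comm]

theorem continuous_trigPoly (p q : ℂ[X]) :
    Continuous fun w => p.eval w + (starRingEnd ℂ) (q.eval w) :=
  p.continuous.add (Complex.continuous_conj.comp q.continuous)

theorem integral_trigPoly {μ : Measure ℂ} [IsFiniteMeasure μ] (hμ : ∀ᵐ w ∂μ, ‖w‖ = 1)
    (p q : ℂ[X]) : ∫ w, (p.eval w + (starRingEnd ℂ) (q.eval w)) ∂μ =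
      ∫ w, p.eval w ∂μ + (starRingEnd ℂ) (∫ w, q.eval w ∂μ) := by
  have hq : Integrable (fun w => (starRingEnd ℂ) (q.eval w)) μ :=
    integrable_of_continuous_of_circle hμ (Complex.continuous_conj.comp q.continuous)
  rw [integral_add (integrable_of_continuous_of_circle hμ p.continuous) hq, integral_conj]

/-- Probability measures on the unit circle with the same moments agree. -/
theorem eq_of_moments_eq {μ ν : Measure ℂ} [IsProbabilityMeasure μ] [IsProbabilityMeasure ν]
    (hμ : ∀ᵐ w ∂μ, ‖w‖ = 1) (hν : ∀ᵐ w ∂ν, ‖w‖ = 1)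
    (h : ∀ k : ℕ, ∫ w, w ^ (k + 1) ∂μ = ∫ w, w ^ (k + 1) ∂ν) : μ = ν := by
  refine ext_of_forall_integral_eq_of_IsFiniteMeasure fun f => ?_
  have hf : Continuous fun w => (f w : ℂ) := Complex.continuous_ofReal.comp f.continuous
  have key : ∫ w, (f w : ℂ) ∂μ = ∫ w, (f w : ℂ) ∂ν := by
    refine eq_of_forall_dist_le fun ε hε => ?_
    obtain ⟨p, q, hpq⟩ := exists_trigPoly_approx hf (half_pos hε)
    have hint : ∀ {κ : Measure ℂ} [IsProbabilityMeasure κ], (∀ᵐ w ∂κ, ‖w‖ = 1) →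
        ‖∫ w, (f w : ℂ) ∂κ - ∫ w, (p.eval w + (starRingEnd ℂ) (q.eval w)) ∂κ‖ ≤ ε / 2 := by
      intro κ _ hκ
      rw [← integral_sub (integrable_of_continuous_of_circle hκ hf)
        (integrable_of_continuous_of_circle hκ (continuous_trigPoly p q))]
      refine (norm_integral_le_of_norm_le_const (C := ε / 2) ?_).trans (by simp)
      filter_upwards [hκ] with w hw using hpq w hw
    have hμν : ∀ p : ℂ[X], ∫ w, p.eval w ∂μ = ∫ w, p.eval w ∂ν := fun p => by
      rw [integral_eval_polynomial hμ, integral_eval_polynomial hν]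
      simp_rw [h]
    have h1 := hint hμ
    have h2 := hint hν
    rw [integral_trigPoly hμ, hμν, hμν, ← integral_trigPoly hν] at h1
    rw [dist_eq_norm]
    have h3 := norm_sub_le_norm_sub_add_norm_sub (∫ w, (f w : ℂ) ∂μ)
      (∫ w, (p.eval w + (starRingEnd ℂ) (q.eval w)) ∂ν) (∫ w, (f w : ℂ) ∂ν)
    rw [norm_sub_rev] at h2
    linarith
  rw [integral_complex_ofReal, integral_complex_ofReal] at key
  exact_mod_cast key

theorem isProbabilityMeasure_uniformCircle : IsProbabilityMeasure uniformCircle := by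
  have : IsProbabilityMeasure (cond (volume : Measure ℝ) (Set.Ioc 0 (2 * Real.pi))) :=
    cond_isProbabilityMeasure_of_finite (by simp [Real.pi_pos])
      (by rw [Real.volume_Ioc]; exact ENNReal.ofReal_ne_top)
  exact Measure.isProbabilityMeasure_map (measurable_circleMap 0 1).aemeasurable

theorem ae_uniformCircle_norm : ∀ᵐ w ∂uniformCircle, ‖w‖ = 1 := by
  rw [uniformCircle, ae_map_iff (measurable_circleMap 0 1).aemeasurable
    (measurableSet_eq_fun measurable_norm measurable_const)]
  exact Eventually.of_forall fun θ => by simp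

theorem integral_pow_uniformCircle (k : ℕ) : ∫ w, w ^ (k + 1) ∂uniformCircle = 0 := by
  rw [uniformCircle, integral_map (measurable_circleMap 0 1).aemeasurable
    (by fun_prop), ProbabilityTheory.cond, integral_smul_measure]
  have hc : ((k + 1 : ℕ) : ℂ) * Complex.I ≠ 0 :=
    mul_ne_zero (Nat.cast_ne_zero.2 k.succ_ne_zero) Complex.I_ne_zero
  have h1 : ∫ θ in Set.Ioc 0 (2 * Real.pi), circleMap 0 1 θ ^ (k + 1) = 0 := by
    rw [← intervalIntegral.integral_of_le (by positivity)]
    have h2 : ∀ θ : ℝ, circleMap 0 1 θ ^ (k + 1) =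
        Complex.exp (((k + 1 : ℕ) : ℂ) * Complex.I * θ) := fun θ => by
      rw [circleMap_zero, Complex.ofReal_one, one_mul, ← Complex.exp_nat_mul]
      ring_nf
    simp_rw [h2]
    rw [integral_exp_mul_complex hc]
    have h3 : ((k + 1 : ℕ) : ℂ) * Complex.I * ((2 * Real.pi : ℝ) : ℂ) =
        ((k + 1 : ℕ) : ℂ) * (2 * Real.pi * Complex.I) := by push_cast; ring
    rw [h3, Complex.exp_nat_mul_two_pi_mul_I]
    simp
  rw [h1, smul_zero]

/-- The uniform distribution has all moments of positive order zero, and moments determine a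
probability measure on the circle. -/
theorem exists_moment_ne_zero {μ : Measure ℂ} [IsProbabilityMeasure μ]
    (hμ : ∀ᵐ w ∂μ, ‖w‖ = 1) (h : μ ≠ uniformCircle) : ∃ k : ℕ, ∫ w, w ^ (k + 1) ∂μ ≠ 0 := by
  have := isProbabilityMeasure_uniformCircle
  by_contra! h0
  exact h (eq_of_moments_eq hμ ae_uniformCircle_norm fun k => by
    rw [h0, integral_pow_uniformCircle])

end TrigApproximation

/-! ### From moments and concentration to weak convergence. -/

section WeakConvergence

theorem toMeasure_multiset_sum (s : Multiset ℂ) :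
    (((s.map fun w => (diracProba w).toFiniteMeasure).sum : FiniteMeasure ℂ) : Measure ℂ) =
      (s.map fun w => Measure.dirac w).sum := by
  induction s using Multiset.induction_on with
  | empty => simp
  | cons a s ih =>
    simp only [Multiset.map_cons, Multiset.sum_cons, FiniteMeasure.toMeasure_add, ih]
    rfl

theorem integral_multiset_sum_dirac (s : Multiset ℂ) (g : ℂ → ℝ) :
    Integrable g (s.map fun w => Measure.dirac w).sum ∧
      ∫ w, g w ∂(s.map fun w => Measure.dirac w).sum = (s.map g).sum := by
  induction s using Multiset.induction_on with
  | empty => simp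
  | cons a s ih =>
    simp only [Multiset.map_cons, Multiset.sum_cons]
    have ha : Integrable g (Measure.dirac a) := integrable_dirac (by simp)
    exact ⟨ha.add_measure ih.1, by rw [integral_add_measure ha ih.1, ih.2, integral_dirac]⟩

theorem integral_zeroMeasure (n : ℕ) (Q : ℂ[X]) (g : ℂ → ℝ) :
    ∫ w, g w ∂(zeroMeasure n Q : Measure ℂ) = ((n - 1 : ℕ) : ℝ)⁻¹ * (Q.roots.map g).sum := by
  rw [zeroMeasure, FiniteMeasure.toMeasure_smul, integral_smul_nnreal_measure,
    toMeasure_multiset_sum, (integral_multiset_sum_dirac _ g).2]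
  simp only [NNReal.smul_def, NNReal.coe_inv, NNReal.coe_natCast, smul_eq_mul]

/-- Splits a sum over zeros into the few exceptional ones, bounded crudely by `B`, and the rest,
bounded by the small `a`. -/
theorem norm_multiset_sum_le_card (s : Multiset ℂ) (p : ℂ → Prop) [DecidablePred p] {h : ℂ → ℂ}
    {a B : ℝ} (ha : 0 ≤ a) (h1 : ∀ w ∈ s, p w → ‖h w‖ ≤ B) (h2 : ∀ w ∈ s, ¬ p w → ‖h w‖ ≤ a) :
    ‖(s.map h).sum‖ ≤ a * Multiset.card s + B * Multiset.card (s.filter p) := by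
  induction s using Multiset.induction_on with
  | empty => simp
  | cons w s ih =>
    have ih' := ih (fun v hv => h1 v (Multiset.mem_cons_of_mem hv))
      fun v hv => h2 v (Multiset.mem_cons_of_mem hv)
    have hle := norm_add_le (h w) (s.map h).sum
    rw [Multiset.map_cons, Multiset.sum_cons, Multiset.card_cons]
    by_cases hw : p w
    · have := h1 w (Multiset.mem_cons_self w s) hw
      rw [Multiset.filter_cons_of_pos _ hw, Multiset.card_cons]
      push_cast
      linarith
    · have := h2 w (Multiset.mem_cons_self w s) hw
      rw [Multiset.filter_cons_of_neg _ hw]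
      push_cast
      linarith

/-- Compare `w` with its radial projection to the circle and use uniform continuity on the disk of
radius `2`. Taking `η ≤ 1` keeps `w` nonzero and inside that disk. -/
theorem exists_norm_le_near_circle {h : ℂ → ℂ} (hh : Continuous h) {ε : ℝ} (hε : 0 < ε)
    (hb : ∀ w, ‖w‖ = 1 → ‖h w‖ ≤ ε) :
    ∃ η : ℝ, 0 < η ∧ ∀ w, |‖w‖ - 1| < η → ‖h w‖ ≤ 2 * ε := by
  have huc := (isCompact_closedBall (0 : ℂ) 2).uniformContinuousOn_of_continuous hh.continuousOn
  obtain ⟨η, hη, hd⟩ := Metric.uniformContinuousOn_iff.1 huc ε hε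
  refine ⟨min η 1, by positivity, fun w hw => ?_⟩
  obtain ⟨hw1, hw2⟩ := lt_min_iff.1 hw
  have hpos : 0 < ‖w‖ := by linarith [(abs_lt.1 hw2).1]
  have hv : ‖w / ‖w‖‖ = 1 := by
    rw [norm_div, Complex.norm_real, norm_norm, div_self hpos.ne']
  have hdist : dist w (w / ‖w‖) < η := by
    have h0 : (‖w‖ : ℂ) ≠ 0 := by exact_mod_cast hpos.ne'
    have h3 : w - w / ‖w‖ = (w / ‖w‖) * ((‖w‖ - 1 : ℝ) : ℂ) := by
      push_cast
      field_simp
    rw [dist_eq_norm, h3, norm_mul, hv, one_mul, Complex.norm_real]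
    exact hw1
  have h4 := hd w (by rw [mem_closedBall_zero_iff]; linarith [(abs_lt.1 hw2).2])
    (w / ‖w‖) (by rw [mem_closedBall_zero_iff, hv]; norm_num) hdist
  rw [dist_eq_norm] at h4
  have h5 := norm_le_norm_add_norm_sub (h (w / ‖w‖)) (h w)
  rw [norm_sub_rev] at h5
  linarith [hb _ hv]

theorem tendsto_average_polynomial {μ : Measure ℂ} [IsProbabilityMeasure μ]
    (hμ : ∀ᵐ w ∂μ, ‖w‖ = 1) {W : ℕ → Multiset ℂ}
    (hcard : ∀ᶠ n in atTop, Multiset.card (W n) = n - 1)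
    (hpow : ∀ k : ℕ, Tendsto (fun n => ((n - 1 : ℕ) : ℂ)⁻¹ * ((W n).map fun w => w ^ (k + 1)).sum)
      atTop (𝓝 (∫ w, w ^ (k + 1) ∂μ))) (p : ℂ[X]) :
    Tendsto (fun n => ((n - 1 : ℕ) : ℂ)⁻¹ * ((W n).map fun w => p.eval w).sum) atTop
      (𝓝 (∫ w, p.eval w ∂μ)) := by
  induction p using Polynomial.induction_on' with
  | add p q hp hq =>
    simp only [eval_add, Multiset.sum_map_add, mul_add]
    rw [integral_add (integrable_of_continuous_of_circle hμ p.continuous)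
      (integrable_of_continuous_of_circle hμ q.continuous)]
    exact hp.add hq
  | monomial k a =>
    simp only [eval_monomial, Multiset.sum_map_mul_left, integral_const_mul]
    simp_rw [mul_left_comm _ a]
    refine Tendsto.const_mul _ ?_
    cases k with
    | succ k => exact hpow k
    | zero =>
      simp only [pow_zero, Multiset.map_const', Multiset.sum_replicate, integral_const,
        probReal_univ, one_smul, nsmul_eq_mul, mul_one]
      refine tendsto_const_nhds.congr' ?_
      filter_upwards [hcard, eventually_ge_atTop 2] with n hn hn2
      rw [hn, inv_mul_cancel₀]
      exact_mod_cast (by omega : n - 1 ≠ 0)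

/-- Empirical measures of zeros that accumulate only at the unit circle converge weakly as soon as
their moments converge. -/
theorem tendsto_zeroMeasure {μ : ProbabilityMeasure ℂ} (hμ : ∀ᵐ w ∂(μ : Measure ℂ), ‖w‖ = 1)
    {Q : ℕ → ℂ[X]} {M : ℝ} (hcard : ∀ᶠ n in atTop, Multiset.card (Q n).roots = n - 1)
    (hM : ∀ᶠ n in atTop, ∀ w ∈ (Q n).roots, ‖w‖ ≤ M)
    (hpow : ∀ k : ℕ, Tendsto
      (fun n => ((n - 1 : ℕ) : ℂ)⁻¹ * ((Q n).roots.map fun w => w ^ (k + 1)).sum)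
      atTop (𝓝 (∫ w, w ^ (k + 1) ∂(μ : Measure ℂ))))
    (hconc : ∀ η > 0, Tendsto (fun n => ((n - 1 : ℕ) : ℝ)⁻¹ *
      Multiset.card ((Q n).roots.filter fun w => η ≤ |‖w‖ - 1|)) atTop (𝓝 0)) :
    Tendsto (fun n => zeroMeasure n (Q n)) atTop (𝓝 μ.toFiniteMeasure) := by
  rw [FiniteMeasure.tendsto_iff_forall_integral_tendsto]
  intro f
  have hf : Continuous fun w => (f w : ℂ) := Complex.continuous_ofReal.comp f.continuous
  rw [Metric.tendsto_nhds]
  intro ε hε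
  have hε8 : 0 < ε / 8 := by positivity
  obtain ⟨p, q, hpq⟩ := exists_trigPoly_approx hf hε8
  set T : ℂ → ℂ := fun w => p.eval w + (starRingEnd ℂ) (q.eval w) with hT
  have hTc : Continuous T := continuous_trigPoly p q
  set h : ℂ → ℂ := fun w => f w - T w with hh
  have hhc : Continuous h := hf.sub hTc
  obtain ⟨η, hη, hnear⟩ := exists_norm_le_near_circle hhc hε8 hpq
  obtain ⟨B, hB⟩ := (isCompact_closedBall (0 : ℂ) M).exists_bound_of_continuousOn hhc.continuousOn
  have hTlim : Tendsto (fun n => ((n - 1 : ℕ) : ℂ)⁻¹ * ((Q n).roots.map T).sum) atTop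
      (𝓝 (∫ w, T w ∂(μ : Measure ℂ))) := by
    rw [hT, integral_trigPoly hμ]
    have h1 := tendsto_average_polynomial hμ hcard hpow p
    have h2 := (Complex.continuous_conj.tendsto _).comp
      (tendsto_average_polynomial hμ hcard hpow q)
    refine (h1.add h2).congr fun n => ?_
    simp only [Function.comp_apply, map_mul, map_inv₀, map_natCast, map_multiset_sum,
      Multiset.map_map, Multiset.sum_map_add, mul_add]
  have hTint : ‖∫ w, (f w : ℂ) ∂(μ : Measure ℂ) - ∫ w, T w ∂(μ : Measure ℂ)‖ ≤ ε / 8 := by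
    rw [← integral_sub (integrable_of_continuous_of_circle hμ hf)
        (integrable_of_continuous_of_circle hμ hTc)]
    refine (norm_integral_le_of_norm_le_const (C := ε / 8) ?_).trans (by simp)
    filter_upwards [hμ] with w hw using hpq w hw
  have hBconc := (hconc η hη).const_mul B
  rw [mul_zero] at hBconc
  -- Error budget in units of `ε / 8`: zeros near the circle cost two, zeros off it one, the
  -- averages of `T` one, and the integral of `f - T` one.
  filter_upwards [hcard, hM, eventually_ge_atTop 2, hBconc.eventually (gt_mem_nhds hε8),
    Metric.tendsto_nhds.1 hTlim _ hε8] with n h1 h2 h3 h4 h5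
  have hn : (0 : ℝ) < ((n - 1 : ℕ) : ℝ) := by exact_mod_cast (by omega : 0 < n - 1)
  have hsum : ‖((Q n).roots.map h).sum‖ ≤ (2 * (ε / 8)) * ((n - 1 : ℕ) : ℝ) +
      B * Multiset.card ((Q n).roots.filter fun w => η ≤ |‖w‖ - 1|) := by
    rw [← h1]
    refine norm_multiset_sum_le_card _ _ (by positivity) (fun w hw _ => ?_) fun w _ hw => ?_
    · exact hB w (mem_closedBall_zero_iff.2 (h2 w hw))
    · exact hnear w (not_le.1 hw)
  have hsum' : ‖((n - 1 : ℕ) : ℂ)⁻¹ * ((Q n).roots.map h).sum‖ ≤ 3 * (ε / 8) := by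
    rw [norm_mul, norm_inv, Complex.norm_natCast]
    calc _ ≤ ((n - 1 : ℕ) : ℝ)⁻¹ * ((2 * (ε / 8)) * ((n - 1 : ℕ) : ℝ) +
          B * Multiset.card ((Q n).roots.filter fun w => η ≤ |‖w‖ - 1|)) := by gcongr
      _ = 2 * (ε / 8) + B * (((n - 1 : ℕ) : ℝ)⁻¹ *
          Multiset.card ((Q n).roots.filter fun w => η ≤ |‖w‖ - 1|)) := by
          field_simp
      _ ≤ _ := by linarith
  have hval : ((∫ w, f w ∂(zeroMeasure n (Q n) : Measure ℂ) : ℝ) : ℂ) =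
      ((n - 1 : ℕ) : ℂ)⁻¹ * ((Q n).roots.map h).sum +
        ((n - 1 : ℕ) : ℂ)⁻¹ * ((Q n).roots.map T).sum := by
    rw [integral_zeroMeasure n (Q n) f, ← mul_add, ← Multiset.sum_map_add]
    rw [Complex.ofReal_mul, Complex.ofReal_inv, Complex.ofReal_natCast,
      ← Complex.ofRealHom_eq_coe (Multiset.sum _), map_multiset_sum, Multiset.map_map]
    simp [hh]
  have hval2 : ((∫ w, f w ∂(μ.toFiniteMeasure : Measure ℂ) : ℝ) : ℂ) =
      ∫ w, (f w : ℂ) ∂(μ : Measure ℂ) := integral_complex_ofReal.symm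
  rw [← Complex.isometry_ofReal.dist_eq, hval, hval2]
  rw [dist_eq_norm] at h5 ⊢
  set A := ((n - 1 : ℕ) : ℂ)⁻¹ * ((Q n).roots.map h).sum
  set D := ((n - 1 : ℕ) : ℂ)⁻¹ * ((Q n).roots.map T).sum
  have h6 : A + D - ∫ w, (f w : ℂ) ∂(μ : Measure ℂ) = A + (D - ∫ w, T w ∂(μ : Measure ℂ)) -
      (∫ w, (f w : ℂ) ∂(μ : Measure ℂ) - ∫ w, T w ∂(μ : Measure ℂ)) := by ring
  rw [h6]
  have h7 := norm_sub_le (A + (D - ∫ w, T w ∂(μ : Measure ℂ)))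
    (∫ w, (f w : ℂ) ∂(μ : Measure ℂ) - ∫ w, T w ∂(μ : Measure ℂ))
  have h8 := norm_add_le A (D - ∫ w, T w ∂(μ : Measure ℂ))
  linarith

end WeakConvergence

/-! ### Convergence for a fixed realisation. -/

section Deterministic

theorem card_filter_le_add (s : Multiset ℂ) (p q r : ℂ → Prop) [DecidablePred p]
    [DecidablePred q] [DecidablePred r] (h : ∀ w, p w → q w ∨ r w) :
    Multiset.card (s.filter p) ≤ Multiset.card (s.filter q) + Multiset.card (s.filter r) := by
  rw [← Multiset.card_add, Multiset.filter_add_filter, Multiset.card_add]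
  exact (Multiset.card_le_card (Multiset.monotone_filter_right s h)).trans (Nat.le_add_right _ _)

theorem tendsto_inv_natCast_sub_one (𝕜 : Type*) [RCLike 𝕜] :
    Tendsto (fun n : ℕ => ((n - 1 : ℕ) : 𝕜)⁻¹) atTop (𝓝 0) :=
  (tendsto_inv_atTop_nhds_zero_nat (𝕜 := 𝕜)).comp (tendsto_sub_atTop_nat 1)

/-- The zeros of generalized derivatives of polynomials with zeros on the unit circle are
asymptotically distributed like the zeros of these polynomials. -/
theorem tendsto_zeroMeasure_genDeriv {μ : ProbabilityMeasure ℂ}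
    (hμ : ∀ᵐ w ∂(μ : Measure ℂ), ‖w‖ = 1) {z : ℕ → ℂ} (hz : ∀ j, ‖z j‖ = 1)
    (hmom : ∀ k : ℕ, Tendsto (fun n : ℕ => (n : ℂ)⁻¹ * ∑ j ∈ Finset.range n, z j ^ (k + 1)) atTop
      (𝓝 (∫ w, w ^ (k + 1) ∂(μ : Measure ℂ))))
    {lam : ℕ → ℕ → ℂ} {K δ : ℝ} (hδ : 0 < δ)
    (hK : ∀ n ≥ 2, ∑ j ∈ Finset.range n, ‖lam n j‖ ≤ n * K)
    (hd : ∀ n ≥ 2, n * δ ≤ ‖∑ j ∈ Finset.range n, lam n j‖)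
    {b : ℕ → ℂ} (hb : ∃ m, b m ≠ 0)
    (hlim : ∀ m, Tendsto (fun n : ℕ => (1 / (n : ℂ)) *
      ∑ j ∈ Finset.range n, (starRingEnd ℂ) (lam n j) * z j ^ (m + 1)) atTop (𝓝 (b m))) :
    Tendsto (fun n => zeroMeasure n (genDeriv n z (lam n))) atTop (𝓝 μ.toFiniteMeasure) := by
  refine tendsto_zeroMeasure hμ (M := 1 + K / δ) ?_ ?_ (fun k => ?_) fun η hη => ?_
  · filter_upwards [eventually_ge_atTop 2] with n hn
    exact card_roots_genDeriv (sum_ne_zero_of_le_norm hδ (by omega) (hd n hn))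
  · filter_upwards [eventually_ge_atTop 2] with n hn w hw
    exact norm_le_of_mem_roots_genDeriv hδ (by omega) hz (hK n hn) (hd n hn) hw
  · obtain ⟨B, hB⟩ := exists_powerSum_sub_le (K := K) hδ k
    have hinv := tendsto_inv_natCast_sub_one ℂ
    have h1 : Tendsto (fun n : ℕ => ((n - 1 : ℕ) : ℂ)⁻¹ *
        ((∑ j ∈ Finset.range n, z j ^ (k + 1)) -
          ((genDeriv n z (lam n)).roots.map fun w => w ^ (k + 1)).sum)) atTop (𝓝 0) := by
      refine hinv.zero_mul_isBoundedUnder_le ⟨B, ?_⟩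
      rw [eventually_map]
      filter_upwards [eventually_ge_atTop 2] with n hn
      exact hB n z (lam n) (by omega) hz (hK n hn) (hd n hn)
    -- The normalisations `n` and `n - 1` are reconciled by `n / (n - 1) = 1 + 1 / (n - 1)`.
    have h2 := ((hmom k).add (hinv.mul (hmom k))).sub h1
    rw [zero_mul, add_zero, sub_zero] at h2
    refine h2.congr' ?_
    filter_upwards [eventually_ge_atTop 2] with n hn
    have hn0 : (n : ℂ) ≠ 0 := by exact_mod_cast (by omega : n ≠ 0)
    have hn1 : ((n - 1 : ℕ) : ℂ) ≠ 0 := by exact_mod_cast (by omega : n - 1 ≠ 0)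
    have hn2 : ((n - 1 : ℕ) : ℂ) + 1 = n := by exact_mod_cast (by omega : n - 1 + 1 = n)
    field_simp
    rw [← hn2]
    ring
  -- The outer and inner counts are each bounded independently of `n`, so division by `n - 1` sends
  -- them to `0`. The inner count requires `ε < 1`, whereas `η` is arbitrary.
  · obtain ⟨ε, hε, hε1, hεη⟩ : ∃ ε : ℝ, 0 < ε ∧ ε < 1 ∧ ε ≤ η :=
      ⟨min η (1 / 2), by positivity, (min_le_right _ _).trans_lt (by norm_num), min_le_left _ _⟩
    obtain ⟨x, hx, κ, hκ, hev⟩ :=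
      exists_lower_bound_near_zero hz hK hb hlim (r := ε / 4) (by positivity)
    obtain ⟨N₁, hN₁⟩ := exists_card_roots_outer_le K hδ hη
    obtain ⟨N₂, hN₂⟩ := exists_card_roots_inner_le K hκ hε hε1
    have hinv := (tendsto_inv_natCast_sub_one ℝ).mul_const ((N₁ + N₂ : ℕ) : ℝ)
    rw [zero_mul] at hinv
    refine tendsto_of_tendsto_of_tendsto_of_le_of_le' tendsto_const_nhds hinv
      (Eventually.of_forall fun n => by positivity) ?_
    filter_upwards [hev, eventually_ge_atTop 2] with n h1 hn
    gcongr
    refine (card_filter_le_add _ _ (fun w => 1 + η ≤ ‖w‖) (fun w => ‖w‖ ≤ 1 - ε) ?_).trans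
      (add_le_add (hN₁ n z (lam n) (by omega) hz (hK n hn) (hd n hn))
        (hN₂ n z (lam n) x (by omega) hz (sum_ne_zero_of_le_norm hδ (by omega) (hd n hn))
          (hK n hn) hx h1))
    intro w hw
    rcases le_abs.1 hw with h | h
    · left; linarith
    · right; linarith

end Deterministic

/-! ### Almost sure statements and polar derivatives. -/

section Random

variable {Ω : Type*} [MeasurableSpace Ω] {Pr : Measure Ω}

theorem integral_comp_of_law {μ : Measure ℂ} {Z : Ω → ℂ} (hZ_meas : Measurable Z)
    (hZ_law : Pr.map Z = μ) {g : ℂ → ℂ} (hg : Continuous g) :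
    ∫ ω, g (Z ω) ∂Pr = ∫ w, g w ∂μ := by
  rw [← hZ_law, integral_map hZ_meas.aemeasurable hg.aestronglyMeasurable]

/-- The strong law of large numbers for continuous functions of random points of the circle. -/
theorem ae_tendsto_average {μ : Measure ℂ} [IsProbabilityMeasure μ] (hμ : ∀ᵐ w ∂μ, ‖w‖ = 1)
    {Z : ℕ → Ω → ℂ} (hZ_meas : ∀ j, Measurable (Z j)) (hZ_indep : iIndepFun Z Pr)
    (hZ_law : ∀ j, Pr.map (Z j) = μ) {g : ℂ → ℂ} (hg : Continuous g) :
    ∀ᵐ ω ∂Pr, Tendsto (fun n : ℕ => (n : ℂ)⁻¹ * ∑ j ∈ Finset.range n, g (Z j ω)) atTop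
      (𝓝 (∫ w, g w ∂μ)) := by
  have hint : Integrable (fun ω => g (Z 0 ω)) Pr := by
    have h1 := integrable_of_continuous_of_circle hμ hg
    rw [← hZ_law 0] at h1
    exact h1.comp_measurable (hZ_meas 0)
  have := strong_law_ae (fun j ω => g (Z j ω)) hint
    (fun i j hij => (hZ_indep.indepFun hij).comp hg.measurable hg.measurable)
    (fun i => IdentDistrib.comp ⟨(hZ_meas i).aemeasurable, (hZ_meas 0).aemeasurable,
      by rw [hZ_law, hZ_law]⟩ hg.measurable)
  rw [integral_comp_of_law (hZ_meas 0) (hZ_law 0) hg] at this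
  filter_upwards [this] with ω hω
  refine hω.congr fun n => ?_
  rw [Complex.real_smul]
  push_cast
  rfl

theorem ae_norm_eq_one {μ : Measure ℂ} (hμ : ∀ᵐ w ∂μ, ‖w‖ = 1)
    {Z : ℕ → Ω → ℂ} (hZ_meas : ∀ j, Measurable (Z j)) (hZ_law : ∀ j, Pr.map (Z j) = μ) :
    ∀ᵐ ω ∂Pr, ∀ j, ‖Z j ω‖ = 1 := by
  rw [ae_all_iff]
  intro j
  rw [← hZ_law j] at hμ
  exact ae_of_ae_map (hZ_meas j).aemeasurable hμ

/-- The linear bounds in `n` already confine the zeros to the disk of radius `1 + K / δ`, so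
applications need to check only these bounds and the limits. -/
theorem WeightConditions.of_bounds {Z : ℕ → Ω → ℂ} {lam : ℕ → ℕ → Ω → ℂ} {K δ : ℝ}
    (hZ : ∀ᵐ ω ∂Pr, ∀ j, ‖Z j ω‖ = 1) (hK0 : 0 < K) (hδ : 0 < δ)
    (hK : ∀ᵐ ω ∂Pr, ∀ n : ℕ, n ≥ 2 → ∑ j ∈ Finset.range n, ‖lam n j ω‖ ≤ n * K)
    (hd : ∀ᵐ ω ∂Pr, ∀ n : ℕ, n ≥ 2 → n * δ ≤ ‖∑ j ∈ Finset.range n, lam n j ω‖)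
    {b : ℕ → ℂ} (hb : ∃ m, b m ≠ 0) (hlim : ∀ m : ℕ, ∀ᵐ ω ∂Pr,
      Tendsto (fun n : ℕ => (1 / (n : ℂ)) *
        ∑ j ∈ Finset.range n, (starRingEnd ℂ) (lam n j ω) * Z j ω ^ (m + 1)) atTop (𝓝 (b m))) :
    WeightConditions Pr Z lam where
  sum_ne_zero := by
    filter_upwards [hd] with ω hω n hn
    exact sum_ne_zero_of_le_norm hδ (by omega) (hω n hn)
  zeros_bounded := by
    refine ⟨1 + K / δ, by positivity, ?_⟩
    filter_upwards [hZ, hK, hd] with ω h1 h2 h3 n hn w hw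
    exact norm_le_of_mem_roots_genDeriv hδ (by omega) h1 (h2 n hn) (h3 n hn) hw
  moments := ⟨b, hb, hlim⟩
  abs_le := by
    refine ⟨K, hK0, ?_⟩
    filter_upwards [hK] with ω hω n hn
    have hn' : (0 : ℝ) < n := by exact_mod_cast (by omega : 0 < n)
    rw [one_div, inv_mul_le_iff₀ hn']
    exact hω n hn
  le_abs_sum := by
    refine ⟨δ, hδ, ?_⟩
    filter_upwards [hd] with ω hω n hn
    have hn' : (0 : ℝ) < n := by exact_mod_cast (by omega : 0 < n)
    rw [one_div, le_inv_mul_iff₀ hn']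
    exact hω n hn

/-- Only countably many almost sure events are involved, one for each moment and for each limit in
(i); on their intersection the deterministic result applies. -/
theorem WeightConditions.ae_tendsto_zeroMeasure {μ : ProbabilityMeasure ℂ}
    (hμ : ∀ᵐ w ∂(μ : Measure ℂ), ‖w‖ = 1)
    {Z : ℕ → Ω → ℂ} (hZ_meas : ∀ j, Measurable (Z j)) (hZ_indep : iIndepFun Z Pr)
    (hZ_law : ∀ j, Pr.map (Z j) = (μ : Measure ℂ)) {lam : ℕ → ℕ → Ω → ℂ}
    (h : WeightConditions Pr Z lam) :
    ∀ᵐ ω ∂Pr, Tendsto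
      (fun n => zeroMeasure n (genDeriv n (fun j => Z j ω) (fun j => lam n j ω)))
      atTop (𝓝 μ.toFiniteMeasure) := by
  obtain ⟨b, hb, hlim⟩ := h.moments
  obtain ⟨K, -, hK⟩ := h.abs_le
  obtain ⟨δ, hδ, hd⟩ := h.le_abs_sum
  filter_upwards [ae_norm_eq_one hμ hZ_meas hZ_law, ae_all_iff.2 hlim, hK, hd,
    ae_all_iff.2 fun k : ℕ => ae_tendsto_average hμ hZ_meas hZ_indep hZ_law
      (continuous_pow (k + 1))] with ω h1 h2 h3 h4 h5
  refine tendsto_zeroMeasure_genDeriv hμ (lam := fun n j => lam n j ω) h1 h5 hδ (K := K)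
    (fun n hn => ?_) (fun n hn => ?_) hb h2
  · have hn' : (0 : ℝ) < n := by exact_mod_cast (by omega : 0 < n)
    have := h3 n hn
    rwa [one_div, inv_mul_le_iff₀ hn'] at this
  · have hn' : (0 : ℝ) < n := by exact_mod_cast (by omega : 0 < n)
    have := h4 n hn
    rwa [one_div, le_inv_mul_iff₀ hn'] at this

/-- The weights of the polar derivative satisfy the weight conditions. -/
theorem weightConditions_polar {μ : ProbabilityMeasure ℂ}
    (hμ : ∀ᵐ w ∂(μ : Measure ℂ), ‖w‖ = 1)
    {Z : ℕ → Ω → ℂ} (hZ_meas : ∀ j, Measurable (Z j)) (hZ_indep : iIndepFun Z Pr)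
    (hZ_law : ∀ j, Pr.map (Z j) = (μ : Measure ℂ)) {ξ : ℂ} (hξ : 1 < ‖ξ‖)
    (h : (μ : Measure ℂ) ≠ uniformCircle → ∫ ω, Z 0 ω ∂Pr ≠ 0 →
      1 / ‖∫ ω, Z 0 ω ∂Pr‖ < ‖ξ‖) :
    WeightConditions Pr Z (fun _ j ω => ξ - Z j ω) := by
  have hZ := ae_norm_eq_one (Pr := Pr) hμ hZ_meas hZ_law
  -- On the circle `conj (ξ - Z) * Z ^ (m + 1) = conj ξ * Z ^ (m + 1) - Z ^ m`, which gives `b`; the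
  -- index `0` is the one shown to be nonzero.
  refine WeightConditions.of_bounds (K := ‖ξ‖ + 1) (δ := ‖ξ‖ - 1)
    (b := fun m => (starRingEnd ℂ) ξ * ∫ w, w ^ (m + 1) ∂(μ : Measure ℂ) -
      ∫ w, w ^ m ∂(μ : Measure ℂ)) hZ (by positivity) (by linarith) ?_ ?_ ⟨0, ?_⟩ fun m => ?_
  · filter_upwards [hZ] with ω hω n _
    calc ∑ j ∈ Finset.range n, ‖ξ - Z j ω‖ ≤ ∑ j ∈ Finset.range n, (‖ξ‖ + 1) :=
          Finset.sum_le_sum fun j _ => (norm_sub_le _ _).trans_eq (by rw [hω])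
      _ = n * (‖ξ‖ + 1) := by rw [Finset.sum_const, Finset.card_range, nsmul_eq_mul]
  · filter_upwards [hZ] with ω hω n _
    rw [Finset.sum_sub_distrib, Finset.sum_const, Finset.card_range, nsmul_eq_mul]
    have h1 : ‖∑ j ∈ Finset.range n, Z j ω‖ ≤ n :=
      (norm_sum_le _ _).trans_eq (by simp [hω])
    have h2 := norm_sub_norm_le ((n : ℂ) * ξ) (∑ j ∈ Finset.range n, Z j ω)
    rw [norm_mul, Complex.norm_natCast] at h2
    linarith
  · have hE := integral_comp_of_law (hZ_meas 0) (hZ_law 0) continuous_id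
    simp only [id] at hE
    simp only [zero_add, pow_one, pow_zero, integral_const, probReal_univ, one_smul]
    -- If `b 0 = 0`, then `conj ξ * E[Z] = 1`. This forces `E[Z] ≠ 0`, excluding the uniform law,
    -- and `‖ξ‖ = 1 / ‖E[Z]‖`, excluded otherwise.
    intro h0
    by_cases hu : (μ : Measure ℂ) = uniformCircle
    · have h1 := integral_pow_uniformCircle 0
      simp only [zero_add, pow_one] at h1
      rw [hu, h1] at h0
      simp at h0
    · rw [← hE] at h0
      have hne : ∫ ω, Z 0 ω ∂Pr ≠ 0 := by
        intro h1
        rw [h1] at h0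
        simp at h0
      have h2 := h hu hne
      rw [div_lt_iff₀ (norm_pos_iff.2 hne)] at h2
      have h3 := congrArg norm (sub_eq_zero.1 h0)
      rw [norm_mul, RCLike.norm_conj, norm_one] at h3
      linarith
  · filter_upwards [hZ, ae_tendsto_average hμ hZ_meas hZ_indep hZ_law (continuous_pow (m + 1)),
      ae_tendsto_average hμ hZ_meas hZ_indep hZ_law (continuous_pow m)] with ω h1 h2 h3
    refine ((h2.const_mul ((starRingEnd ℂ) ξ)).sub h3).congr fun n => ?_
    rw [mul_left_comm, ← mul_sub, one_div, Finset.mul_sum, ← Finset.sum_sub_distrib]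
    congr 1
    refine Finset.sum_congr rfl fun j _ => ?_
    have h4 : (starRingEnd ℂ) (Z j ω) * Z j ω = 1 := by rw [Complex.conj_mul', h1]; norm_num
    rw [map_sub, sub_mul, pow_succ']
    linear_combination Z j ω ^ m * h4

/-! ### Weighted laws of large numbers and Sz.-Nagy derivatives. -/

variable [IsProbabilityMeasure Pr]

/-- One half of the law of large numbers for triangular arrays of bounded weights. -/
theorem ae_eventually_weighted_average_lt {X : ℕ → Ω → ℝ} (hX_meas : ∀ j, Measurable (X j))
    (hX_indep : iIndepFun X Pr) {D : ℝ} (hD : 0 < D) (hX : ∀ j, ∀ᵐ ω ∂Pr, |X j ω| ≤ D)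
    (hX0 : ∀ j, ∫ ω, X j ω ∂Pr = 0) {c : ℕ → ℕ → ℝ} {M : ℝ} (hM : 0 < M)
    (hc : ∀ n ≥ 2, ∀ j < n, |c n j| ≤ M) {ε : ℝ} (hε : 0 < ε) :
    ∀ᵐ ω ∂Pr, ∀ᶠ n : ℕ in atTop, ∑ j ∈ Finset.range n, c n j * X j ω < n * ε := by
  set s : ℕ → Set Ω := fun n => {ω | n * ε ≤ ∑ j ∈ Finset.range n, c n j * X j ω} with hs
  -- Hoeffding's exponent: each term lies in `[-M D, M D]` and so is sub-Gaussian with variance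
  -- proxy `(M D) ^ 2`, which gives `exp (-(n ε) ^ 2 / (2 n (M D) ^ 2)) = exp (-κ) ^ n`.
  set κ : ℝ := ε ^ 2 / (2 * (M * D) ^ 2) with hκ
  have hκ0 : 0 < κ := by positivity
  have hle : ∀ n ≥ 2, Pr (s n) ≤ ENNReal.ofReal (Real.exp (-κ) ^ n) := by
    intro n hn
    have hn' : (0 : ℝ) < n := by exact_mod_cast (by omega : 0 < n)
    have hsub : ∀ j < n, HasSubgaussianMGF (fun ω => c n j * X j ω)
        ((‖M * D - -(M * D)‖₊ / 2) ^ 2) Pr := by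
      intro j hj
      refine hasSubgaussianMGF_of_mem_Icc_of_integral_eq_zero
        ((hX_meas j).const_mul _).aemeasurable ?_ (by rw [integral_const_mul, hX0, mul_zero])
      filter_upwards [hX j] with ω hω
      rw [Set.mem_Icc, ← abs_le, abs_mul]
      exact mul_le_mul (hc n hn j hj) hω (abs_nonneg _) hM.le
    have hind : iIndepFun (fun j ω => c n j * X j ω) Pr :=
      hX_indep.comp (fun j x => c n j * x) fun j => measurable_const_mul _
    have h1 := HasSubgaussianMGF.measure_sum_range_ge_le_of_iIndepFun hind hsub
      (ε := n * ε) (by positivity)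
    have h2 : (((‖M * D - -(M * D)‖₊ / 2) ^ 2 : ℝ≥0) : ℝ) = (M * D) ^ 2 := by
      push_cast
      rw [sub_neg_eq_add, ← two_mul, Real.norm_eq_abs, abs_of_pos (by positivity)]
      ring
    rw [h2] at h1
    rw [← ofReal_measureReal]
    refine ENNReal.ofReal_le_ofReal (h1.trans_eq ?_)
    rw [← Real.exp_nat_mul, hκ]
    congr 1
    field_simp
  -- Borel–Cantelli works for arrays since it needs no relation between rows; the shift by `2`
  -- reflects that the weights are controlled only from `n = 2` on.
  have hsum : ∑' n, Pr (s (n + 2)) ≠ ⊤ := by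
    have h3 : Summable fun n : ℕ => Real.exp (-κ) ^ (n + 2) :=
      (summable_nat_add_iff 2).2 (summable_geometric_of_lt_one (Real.exp_pos _).le
        (by rw [Real.exp_lt_one_iff]; linarith))
    exact ne_top_of_le_ne_top h3.tsum_ofReal_ne_top
      (ENNReal.tsum_le_tsum fun n => hle (n + 2) (by omega))
  filter_upwards [ae_eventually_notMem hsum] with ω hω
  filter_upwards [(tendsto_sub_atTop_nat 2).eventually hω, eventually_ge_atTop 2] with n h1 hn
  rw [Nat.sub_add_cancel hn] at h1
  exact not_le.1 h1

/-- A law of large numbers for triangular arrays of bounded weights. -/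
theorem ae_tendsto_weighted_average_real {X : ℕ → Ω → ℝ} (hX_meas : ∀ j, Measurable (X j))
    (hX_indep : iIndepFun X Pr) {D : ℝ} (hD : 0 < D) (hX : ∀ j, ∀ᵐ ω ∂Pr, |X j ω| ≤ D)
    (hX0 : ∀ j, ∫ ω, X j ω ∂Pr = 0) {c : ℕ → ℕ → ℝ} {M : ℝ} (hM : 0 < M)
    (hc : ∀ n ≥ 2, ∀ j < n, |c n j| ≤ M) :
    ∀ᵐ ω ∂Pr, Tendsto (fun n : ℕ => (n : ℝ)⁻¹ * ∑ j ∈ Finset.range n, c n j * X j ω) atTop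
      (𝓝 0) := by
  have h1 : ∀ᵐ ω ∂Pr, ∀ k : ℕ, ∀ᶠ n : ℕ in atTop,
      ∑ j ∈ Finset.range n, c n j * X j ω < n * (1 / ((k : ℝ) + 1)) :=
    ae_all_iff.2 fun k => ae_eventually_weighted_average_lt hX_meas hX_indep hD hX hX0 hM hc
      (by positivity)
  have h2 : ∀ᵐ ω ∂Pr, ∀ k : ℕ, ∀ᶠ n : ℕ in atTop,
      ∑ j ∈ Finset.range n, -c n j * X j ω < n * (1 / ((k : ℝ) + 1)) :=
    ae_all_iff.2 fun k => ae_eventually_weighted_average_lt hX_meas hX_indep hD hX hX0 hM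
      (c := fun n j => -c n j) (by simpa using hc) (by positivity)
  filter_upwards [h1, h2] with ω h3 h4
  rw [Metric.tendsto_nhds]
  intro ε hε
  obtain ⟨k, hk⟩ := exists_nat_one_div_lt hε
  filter_upwards [h3 k, h4 k, eventually_ge_atTop 1] with n h5 h6 hn
  have hn' : (0 : ℝ) < n := by exact_mod_cast hn
  simp only [neg_mul, Finset.sum_neg_distrib] at h6
  rw [Real.dist_0_eq_abs, abs_mul, abs_of_pos (inv_pos.2 hn'), inv_mul_lt_iff₀ hn']
  have h7 : (n : ℝ) * (1 / ((k : ℝ) + 1)) < n * ε := by gcongr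
  rw [abs_lt]
  constructor <;> linarith

theorem ae_tendsto_weighted_average {μ : Measure ℂ} [IsProbabilityMeasure μ]
    (hμ : ∀ᵐ w ∂μ, ‖w‖ = 1)
    {Z : ℕ → Ω → ℂ} (hZ_meas : ∀ j, Measurable (Z j)) (hZ_indep : iIndepFun Z Pr)
    (hZ_law : ∀ j, Pr.map (Z j) = μ) {c : ℕ → ℕ → ℝ} {M : ℝ} (hM : 0 < M)
    (hc : ∀ n ≥ 2, ∀ j < n, |c n j| ≤ M) {g : ℂ → ℂ} (hg : Continuous g)
    (hg0 : ∫ w, g w ∂μ = 0) :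
    ∀ᵐ ω ∂Pr, Tendsto (fun n : ℕ => (n : ℂ)⁻¹ * ∑ j ∈ Finset.range n, (c n j : ℂ) * g (Z j ω))
      atTop (𝓝 0) := by
  obtain ⟨B, hB⟩ := (isCompact_sphere (0 : ℂ) 1).exists_bound_of_continuousOn hg.continuousOn
  have hZ := ae_norm_eq_one (Pr := Pr) hμ hZ_meas hZ_law
  have hgB : ∀ j, ∀ᵐ ω ∂Pr, ‖g (Z j ω)‖ ≤ |B| + 1 := fun j => by
    filter_upwards [hZ] with ω hω
    have := hB _ (mem_sphere_zero_iff_norm.2 (hω j))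
    linarith [le_abs_self B]
  have hgint := integrable_of_continuous_of_circle hμ hg
  have hint : ∀ j, Integrable (fun ω => g (Z j ω)) Pr := fun j => by
    have h1 := hgint
    rw [← hZ_law j] at h1
    exact h1.comp_measurable (hZ_meas j)
  have hint0 : ∀ j, ∫ ω, g (Z j ω) ∂Pr = 0 := fun j => by
    rw [integral_comp_of_law (hZ_meas j) (hZ_law j) hg, hg0]
  have hre := ae_tendsto_weighted_average_real (X := fun j ω => (g (Z j ω)).re)
    (fun j => Complex.measurable_re.comp (hg.measurable.comp (hZ_meas j)))
    (hZ_indep.comp (fun _ w => (g w).re) fun _ => Complex.measurable_re.comp hg.measurable)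
    (D := |B| + 1) (by positivity)
    (fun j => by filter_upwards [hgB j] with ω hω using (Complex.abs_re_le_norm _).trans hω)
    (fun j => by
      have := integral_re (hint j)
      rw [hint0 j] at this
      simpa using this) hM hc
  have him := ae_tendsto_weighted_average_real (X := fun j ω => (g (Z j ω)).im)
    (fun j => Complex.measurable_im.comp (hg.measurable.comp (hZ_meas j)))
    (hZ_indep.comp (fun _ w => (g w).im) fun _ => Complex.measurable_im.comp hg.measurable)
    (D := |B| + 1) (by positivity)
    (fun j => by filter_upwards [hgB j] with ω hω using (Complex.abs_im_le_norm _).trans hω)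
    (fun j => by
      have := integral_im (hint j)
      rw [hint0 j] at this
      simpa using this) hM hc
  filter_upwards [hre, him] with ω h1 h2
  have h3 := ((Complex.continuous_ofReal.tendsto _).comp h1).add
    (((Complex.continuous_ofReal.tendsto _).comp h2).mul_const Complex.I)
  simp only [Complex.ofReal_zero, zero_mul, add_zero] at h3
  refine h3.congr fun n => ?_
  simp only [Function.comp_apply, Complex.ofReal_mul, Complex.ofReal_inv, Complex.ofReal_natCast,
    Complex.ofReal_sum]
  rw [mul_assoc, ← mul_add, Finset.sum_mul, ← Finset.sum_add_distrib]
  congr 1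
  refine Finset.sum_congr rfl fun j _ => ?_
  rw [mul_assoc, ← mul_add, Complex.re_add_im]

/-- Bounded deterministic weights of Sz.-Nagy generalized derivatives satisfy the weight
conditions, unless the zeros are uniformly distributed. -/
theorem weightConditions_nagy {μ : ProbabilityMeasure ℂ}
    (hμ : ∀ᵐ w ∂(μ : Measure ℂ), ‖w‖ = 1)
    {Z : ℕ → Ω → ℂ} (hZ_meas : ∀ j, Measurable (Z j)) (hZ_indep : iIndepFun Z Pr)
    (hZ_law : ∀ j, Pr.map (Z j) = (μ : Measure ℂ)) {lam : ℕ → ℕ → Ω → ℝ}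
    (hu : (μ : Measure ℂ) ≠ uniformCircle)
    (hnagy : ∀ n ≥ 2, ∀ᵐ ω ∂Pr, IsNagyWeights n (fun j => lam n j ω))
    (hconst : ∀ n ≥ 2, ∀ j < n, ∃ c : ℝ, ∀ᵐ ω ∂Pr, lam n j ω = c)
    (hbdd : ∃ M : ℝ, 0 < M ∧ ∀ n ≥ 2, ∀ j < n, ∀ᵐ ω ∂Pr, lam n j ω ≤ M) :
    WeightConditions Pr Z (fun n j ω => (lam n j ω : ℂ)) := by
  obtain ⟨M, hM, hbdd⟩ := hbdd
  choose! c hc using hconst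
  have hZ := ae_norm_eq_one (Pr := Pr) hμ hZ_meas hZ_law
  have hnagy' : ∀ᵐ ω ∂Pr, ∀ n ≥ 2, IsNagyWeights n (fun j => lam n j ω) := by
    simpa only [ae_all_iff] using hnagy
  have hc' : ∀ᵐ ω ∂Pr, ∀ n ≥ 2, ∀ j < n, lam n j ω = c n j := by
    simpa only [ae_all_iff] using hc
  have hcM : ∀ n ≥ 2, ∀ j < n, |c n j| ≤ M := by
    intro n hn j hj
    -- An almost sure event of a probability space is nonempty, so the constant inherits positivity
    -- and the bound `M` from a single sample point.
    obtain ⟨ω, h1, h2, h3⟩ := ((hnagy n hn).and ((hc n hn j hj).and (hbdd n hn j hj))).exists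
    rw [← h2, abs_of_pos (h1.1 j hj)]
    exact h3
  refine WeightConditions.of_bounds (K := 1) (δ := 1)
    (b := fun m => ∫ w, w ^ (m + 1) ∂(μ : Measure ℂ)) hZ one_pos one_pos ?_ ?_
    (exists_moment_ne_zero hμ hu) fun m => ?_
  · filter_upwards [hnagy'] with ω hω n hn
    rw [mul_one, ← (hω n hn).2]
    refine Finset.sum_le_sum fun j hj => ?_
    rw [Complex.norm_real, Real.norm_eq_abs, abs_of_pos ((hω n hn).1 j (Finset.mem_range.1 hj))]
  · filter_upwards [hnagy'] with ω hω n hn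
    rw [← Complex.ofReal_sum, (hω n hn).2, mul_one, Complex.ofReal_natCast, Complex.norm_natCast]
  · have hE : ∫ w, (w ^ (m + 1) - ∫ v, v ^ (m + 1) ∂(μ : Measure ℂ)) ∂(μ : Measure ℂ) = 0 := by
      rw [integral_sub (integrable_of_continuous_of_circle hμ (continuous_pow _))
        (integrable_const _)]
      simp
    filter_upwards [hnagy', hc', ae_tendsto_weighted_average hμ hZ_meas hZ_indep hZ_law hM hcM
      (g := fun w => w ^ (m + 1) - ∫ v, v ^ (m + 1) ∂(μ : Measure ℂ))
      ((continuous_pow (m + 1)).sub continuous_const) hE] with ω h1 h2 h3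
    -- The weighted law applies to the centred powers; since the weights sum to `n`, the mean can be
    -- added back.
    have h4 := h3.add_const (∫ v, v ^ (m + 1) ∂(μ : Measure ℂ))
    rw [zero_add] at h4
    refine h4.congr' ?_
    filter_upwards [eventually_ge_atTop 2] with n hn
    have hn0 : (n : ℂ) ≠ 0 := by exact_mod_cast (by omega : n ≠ 0)
    have h5 : ∑ j ∈ Finset.range n, (c n j : ℂ) = n := by
      rw [← Complex.ofReal_sum, ← Complex.ofReal_natCast, ← (h1 n hn).2]
      congr 1
      exact Finset.sum_congr rfl fun j hj => (h2 n hn j (Finset.mem_range.1 hj)).symm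
    have h6 : ∑ j ∈ Finset.range n, (starRingEnd ℂ) (lam n j ω : ℂ) * Z j ω ^ (m + 1) =
        ∑ j ∈ Finset.range n, (c n j : ℂ) * Z j ω ^ (m + 1) :=
      Finset.sum_congr rfl fun j hj => by
        rw [Complex.conj_ofReal, h2 n hn j (Finset.mem_range.1 hj)]
    rw [h6]
    simp_rw [mul_sub]
    rw [Finset.sum_sub_distrib, ← Finset.sum_mul, h5]
    field_simp
    ring

end Random

end RandomZeros

theorem corollary5 {Ω : Type*} [MeasurableSpace Ω] (Pr : Measure Ω) [IsProbabilityMeasure Pr]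
    (μ : ProbabilityMeasure ℂ) (hμ : (μ : Measure ℂ) (Metric.sphere 0 1) = 1)
    (Z : ℕ → Ω → ℂ) (hZ_meas : ∀ j, Measurable (Z j)) (hZ_indep : iIndepFun Z Pr)
    (hZ_law : ∀ j, Pr.map (Z j) = (μ : Measure ℂ)) :
    -- generalized derivatives with random complex weights
    (∀ lam : ℕ → ℕ → Ω → ℂ, WeightConditions Pr Z lam →
      ∀ᵐ ω ∂Pr, Tendsto
        (fun n => zeroMeasure n (genDeriv n (fun j => Z j ω) (fun j => lam n j ω)))
        atTop (𝓝 μ.toFiniteMeasure)) ∧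
    -- polar derivatives
    (∀ ξ : ℂ, 1 < ‖ξ‖ →
      ((μ : Measure ℂ) ≠ uniformCircle → ∫ ω, Z 0 ω ∂Pr ≠ 0 → 1 / ‖∫ ω, Z 0 ω ∂Pr‖ < ‖ξ‖) →
      WeightConditions Pr Z (fun _ j ω => ξ - Z j ω) ∧
      ∀ᵐ ω ∂Pr, Tendsto
        (fun n => zeroMeasure n (polarDerivative ξ (polyOfZeros n (fun j => Z j ω))))
        atTop (𝓝 μ.toFiniteMeasure)) ∧
    -- Sz.-Nagy generalized derivatives with deterministic bounded weights
    (∀ lam : ℕ → ℕ → Ω → ℝ,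
      (μ : Measure ℂ) ≠ uniformCircle →
      (∀ n ≥ 2, ∀ᵐ ω ∂Pr, IsNagyWeights n (fun j => lam n j ω)) →
      (∀ n ≥ 2, ∀ j < n, ∃ c : ℝ, ∀ᵐ ω ∂Pr, lam n j ω = c) →
      (∃ M : ℝ, 0 < M ∧ ∀ n ≥ 2, ∀ j < n, ∀ᵐ ω ∂Pr, lam n j ω ≤ M) →
      WeightConditions Pr Z (fun n j ω => (lam n j ω : ℂ)) ∧
      ∀ᵐ ω ∂Pr, Tendsto
        (fun n => zeroMeasure n (genDeriv n (fun j => Z j ω) (fun j => (lam n j ω : ℂ))))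
        atTop (𝓝 μ.toFiniteMeasure)) := by
  have hμ' : ∀ᵐ w ∂(μ : Measure ℂ), ‖w‖ = 1 := by
    have h1 : Metric.sphere (0 : ℂ) 1 ∈ ae (μ : Measure ℂ) :=
      (mem_ae_iff_prob_eq_one Metric.isClosed_sphere.measurableSet).2 hμ
    filter_upwards [h1] with w hw
    exact mem_sphere_zero_iff_norm.1 hw
  refine ⟨fun lam h => h.ae_tendsto_zeroMeasure hμ' hZ_meas hZ_indep hZ_law,
    fun ξ hξ h => ?_, fun lam hu h1 h2 h3 => ?_⟩
  · have hw := weightConditions_polar hμ' hZ_meas hZ_indep hZ_law hξ h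
    refine ⟨hw, ?_⟩
    simp_rw [polarDerivative_polyOfZeros]
    exact hw.ae_tendsto_zeroMeasure hμ' hZ_meas hZ_indep hZ_law
  · have hw := weightConditions_nagy hμ' hZ_meas hZ_indep hZ_law hu h1 h2 h3
    exact ⟨hw, hw.ae_tendsto_zeroMeasure hμ' hZ_meas hZ_indep hZ_law⟩
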